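/- Fix $\tau,\eta\in\mathbb C$ with $\operatorname{Im}\tau>0$ and $2\eta\notin\mathbb Z+\tau\mathbb Z$, and let $$\theta(t)=-\sum_{j\in\mathbb Z}e^{\pi i(j+\frac12)^2\tau+2\pi i(j+\frac12)(t+\frac12)} .$$ For $\Lambda,z\in\mathbb C$, the evaluation Verma module $V_\Lambda(z)$ of the elliptic quantum group $E_{\tau,\eta}(sl_2)$ has basis $e_0,e_1,e_2,\dots$ (with $e_{-1}=0$), $he_k=(\Lambda-2k)e_k$, and $L$-operator $L(w,\lambda)$ on $V\otimes V_\Lambda(z)$, where $V=\mathbb Ce[1]\oplus\mathbb Ce[-1]$ and $he[\pm1]=\pm e[\pm1]$, given by $$L(w,\lambda)(e[1]\otimes e_k)=e[1]\otimes a(w,\lambda)e_k+e[-1]\otimes c(w,\lambda)e_k,\qquad L(w,\lambda)(e[-1]\otimes e_k)=e[1]\otimes b(w,\lambda)e_k+e[-1]\otimes d(w,\lambda)e_k,$$ $$a(w,\lambda)e_k=\frac{\theta(z-w+(\Lambda+1-2k)\eta)\,\theta(\lambda+2k\eta)}{\theta(z-w+(\Lambda+1)\eta)\,\theta(\lambda)}\,e_k,\qquad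 b(w,\lambda)e_k=-\frac{\theta(-\lambda+z-w+(\Lambda-1-2k)\eta)\,\theta(2\eta)}{\theta(z-w+(\Lambda+1)\eta)\,\theta(\lambda)}\,e_{k+1},$$ $$c(w,\lambda)e_k=-\frac{\theta(-\lambda-z+w+(\Lambda+1-2k)\eta)\,\theta(2(\Lambda+1-k)\eta)\,\theta(2k\eta)}{\theta(z-w+(\Lambda+1)\eta)\,\theta(\lambda)\,\theta(2\eta)}\,e_{k-1},\qquad d(w,\lambda)e_k=\frac{\theta(z-w+(-\Lambda+1+2k)\eta)\,\theta(\lambda-2(\Lambda-k)\eta)}{\theta(z-w+(\Lambda+1)\eta)\,\theta(\lambda)}\,e_k .$$ Let $\Lambda_1,\dots,\Lambda_n,z_1,\dots,z_n\in\mathbb C$ and let $W=V_{\Lambda_1}(z_1)\otimes\cdots\otimes V_{\Lambda_n}(z_n)$, with $L$-operator on $V\otimes W$ (the factor $V$ has number $0$) $$L(w,\lambda)=L_1^{(01)}\Bigl(w,\lambda-2\eta\sum_{l=2}^nh^{(l)}\Bigr)\cdots L_{n-1}^{(0,n-1)}\bigl(w,\lambda-2\eta h^{(n)}\bigr)\,L_n^{(0n)}(w,\lambda),$$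 where $L_k$ is the $L$-operator of $V_{\Lambda_k}(z_k)$ and $h^{(l)}$ is $h$ acting on the $l$-th factor. The operator $b(w)$ acts on meromorphic functions $f$ of $\lambda\in\mathbb C$ with values in $W$: $(b(w)f)(\lambda)$ is the $e[1]$-component of $L(w,\lambda)\bigl(e[-1]\otimes f(\lambda+2\eta)\bigr)$. Put $p_k=z_k+\eta(-\Lambda_k+1)$, $q_k=z_k+\eta(\Lambda_k+1)$, and for $m\ge 0$ and $c\in\mathbb C$ put $$v(\lambda)=e^{c\lambda}\prod_{j=1}^m\frac{\theta(\lambda-2\eta j)}{\theta(2\eta)}\;e_0\otimes\cdots\otimes e_0 .$$ Let $t_1,\dots,t_m\in\mathbb C$ be such that $t_i\ne t_j \bmod \mathbb Z+\tau\mathbb Z$ for $i<j$ and $t_i\neq q_k\bmod\mathbb Z+\tau\mathbb Z$ for all $i,k$. Then, as meromorphic functions of $\lambda$, $$b(t_1)\cdots b(t_m)v=(-1)^me^{c(\lambda+2\eta m)}\sum_{I_1,\dots,I_n}\;\prod_{l=1}^n\prod_{i\in I_l}\prod_{k=l+1}^n\frac{\theta(t_i-p_k)}{\theta(t_i-q_k)}\;\prod_{k<l}\prod_{i\in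 I_k,\,j\in I_l}\frac{\theta(t_i-t_j-2\eta)}{\theta(t_i-t_j)}$$ $$\qquad\times\prod_{k=1}^n\prod_{j\in I_k}\frac{\theta\bigl(\lambda+t_j-q_k+2\eta m_k-2\eta\sum_{l=k+1}^n(\Lambda_l-2m_l)\bigr)}{\theta(t_j-q_k)}\;e_{m_1}\otimes\cdots\otimes e_{m_n},$$ where the sum is over all partitions of $\{1,\dots,m\}$ into $n$ disjoint (possibly empty) subsets $I_1,\dots,I_n$ and $m_k=|I_k|$. In particular $b(t_1)\cdots b(t_m)v$ extends to an entire function $\psi$ of $\lambda$ with values in $W$, and $\psi(\lambda+1)=(-1)^me^c\psi(\lambda)$ for all $\lambda\in\mathbb C$. -/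

import Mathlib

noncomputable section

namespace EllipticBethe

/-- Jacobi's theta function
`θ(t) = -∑_{j ∈ ℤ} exp (π i (j + 1/2)² τ + 2 π i (j + 1/2) (t + 1/2))`. -/
def theta (τ t : ℂ) : ℂ :=
  -∑' j : ℤ, Complex.exp
    (Real.pi * Complex.I * ((j : ℂ) + 1 / 2) ^ 2 * τ
      + 2 * Real.pi * Complex.I * ((j : ℂ) + 1 / 2) * (t + 1 / 2))

/-- The lattice `ℤ + τ ℤ`. -/
def lattice (τ : ℂ) : Set ℂ := {u | ∃ a b : ℤ, u = a + b * τ}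

/-- `p = z + η (-Λ + 1)`. -/
def pPar (η Λ z : ℂ) : ℂ := z + η * (-Λ + 1)

/-- `q = z + η (Λ + 1)`. -/
def qPar (η Λ z : ℂ) : ℂ := z + η * (Λ + 1)

/-! ### The evaluation Verma module `V_Λ(z)`

It has basis `e_0, e_1, …` with `h e_k = (Λ - 2k) e_k`. The auxiliary two dimensional space `V` has
basis `e[1], e[-1]`, indexed by `ℤˣ = {1, -1}`, with `h e[α] = α e[α]`. If a space `W` has a basis
indexed by `B`, then `W` is modelled by `B →₀ ℂ` and `V ⊗ W` by `(ℤˣ × B) →₀ ℂ`, with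
`e[α] ⊗ e_b` being `Finsupp.single (α, b) 1`.

The matrix elements of the `L`-operator at spectral parameter `w` and dynamical parameter `x` (the
variable usually called `λ`) are
`a(w,x) e_k = vermaA e_k`, `b(w,x) e_k = vermaB e_{k+1}`, `c(w,x) e_k = vermaC e_{k-1}` (and
`c(w,x) e_0 = 0`), `d(w,x) e_k = vermaD e_k`. -/

def vermaA (τ η Λ z w x : ℂ) (k : ℕ) : ℂ :=
  theta τ (z - w + (Λ + 1 - 2 * k) * η) / theta τ (z - w + (Λ + 1) * η)
    * (theta τ (x + 2 * k * η) / theta τ x)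

def vermaB (τ η Λ z w x : ℂ) (k : ℕ) : ℂ :=
  -(theta τ (-x + z - w + (Λ - 1 - 2 * k) * η) / theta τ (z - w + (Λ + 1) * η)
    * (theta τ (2 * η) / theta τ x))

def vermaC (τ η Λ z w x : ℂ) (k : ℕ) : ℂ :=
  -(theta τ (-x - z + w + (Λ + 1 - 2 * k) * η) / theta τ (z - w + (Λ + 1) * η)
    * (theta τ (2 * (Λ + 1 - k) * η) / theta τ x)
    * (theta τ (2 * k * η) / theta τ (2 * η)))

def vermaD (τ η Λ z w x : ℂ) (k : ℕ) : ℂ :=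
  theta τ (z - w + (-Λ + 1 + 2 * k) * η) / theta τ (z - w + (Λ + 1) * η)
    * (theta τ (x - 2 * (Λ - k) * η) / theta τ x)

/-- The value on `e[α] ⊗ e_k` of the `L`-operator of `V_Λ(z)`:
`L(w,x) (e[1] ⊗ e_k) = e[1] ⊗ a(w,x) e_k + e[-1] ⊗ c(w,x) e_k`,
`L(w,x) (e[-1] ⊗ e_k) = e[1] ⊗ b(w,x) e_k + e[-1] ⊗ d(w,x) e_k`. -/
def vermaLBasis (τ η Λ z w x : ℂ) (α : ℤˣ) (k : ℕ) : (ℤˣ × ℕ) →₀ ℂ :=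
  if α = 1 then
    Finsupp.single (1, k) (vermaA τ η Λ z w x k)
      + (if k = 0 then 0 else Finsupp.single (-1, k - 1) (vermaC τ η Λ z w x k))
  else
    Finsupp.single (1, k + 1) (vermaB τ η Λ z w x k)
      + Finsupp.single (-1, k) (vermaD τ η Λ z w x k)

/-! ### The tensor product `W = V_{Λ_1}(z_1) ⊗ ⋯ ⊗ V_{Λ_n}(z_n)` -/

/-- The underlying vector space of `W`: the basis vector `e_{κ_1} ⊗ ⋯ ⊗ e_{κ_n}` is
`Finsupp.single κ 1`. -/
abbrev TensorSpace (n : ℕ) : Type := (Fin n → ℕ) →₀ ℂ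

/-- `V ⊗ W`. -/
abbrev AuxTensorSpace (n : ℕ) : Type := (ℤˣ × (Fin n → ℕ)) →₀ ℂ

/-- The operator `L_k^{(0k)}(w, x - 2η ∑_{l > k} h^{(l)})` on `V ⊗ W`, where `L_k` is the
`L`-operator of the `k`-th factor `V_{Λ_k}(z_k)`, the auxiliary space `V` has number `0`, and
`h^{(l)}` has the eigenvalue `Λ_l - 2 κ_l` on `e_{κ_1} ⊗ ⋯ ⊗ e_{κ_n}`. -/
def siteL (τ η : ℂ) {n : ℕ} (Λ z : Fin n → ℂ) (w x : ℂ) (k : Fin n) :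
    Module.End ℂ (AuxTensorSpace n) :=
  Finsupp.linearCombination ℂ fun v : ℤˣ × (Fin n → ℕ) =>
    Finsupp.mapDomain (fun u : ℤˣ × ℕ => (u.1, Function.update v.2 k u.2))
      (vermaLBasis τ η (Λ k) (z k) w
        (x - 2 * η * ∑ l ∈ Finset.Ioi k, (Λ l - 2 * (v.2 l : ℂ))) v.1 (v.2 k))

/-- The `L`-operator of the tensor product,
`L(w,x) = L_1^{(01)}(w, x - 2η ∑_{l ≥ 2} h^{(l)}) ⋯ L_{n-1}^{(0,n-1)}(w, x - 2η h^{(n)})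
L_n^{(0n)}(w, x)`. -/
def tensorL (τ η : ℂ) {n : ℕ} (Λ z : Fin n → ℂ) (w x : ℂ) : Module.End ℂ (AuxTensorSpace n) :=
  ((List.finRange n).map (siteL τ η Λ z w x)).prod

/-! ### The operators `a(w), b(w), c(w), d(w)` -/

/-- The vector `e[α] ⊗ v ∈ V ⊗ W`. -/
def auxTensor {n : ℕ} (α : ℤˣ) (v : TensorSpace n) : AuxTensorSpace n :=
  Finsupp.mapDomain (Prod.mk α) v

/-- The vector `v_β` in the decomposition `u = e[1] ⊗ v_1 + e[-1] ⊗ v_{-1}` of `u ∈ V ⊗ W`. -/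
def auxComponent {n : ℕ} (β : ℤˣ) (u : AuxTensorSpace n) : TensorSpace n :=
  Finsupp.comapDomain (Prod.mk β) u (Prod.mk_right_injective β).injOn

/-- The matrix element `e[α] → e[β]` of the operator
`(L̃(w) (e[α] ⊗ f))(x) = L(w,x) (e[α] ⊗ f(x - 2ηα))`.

Meromorphic functions with values in `W` are represented by functions on `ℂ`, two of which
represent the same meromorphic function iff they agree on a codiscrete set (the complement of a
closed discrete set). The values at poles are irrelevant. -/
def entryOp (τ η : ℂ) {n : ℕ} (Λ z : Fin n → ℂ) (β α : ℤˣ) (w : ℂ) (f : ℂ → TensorSpace n) :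
    ℂ → TensorSpace n :=
  fun x => auxComponent β
    (tensorL τ η Λ z w x (auxTensor α (f (x - 2 * η * ((α : ℤ) : ℂ)))))

/-- The operator `b(w)`: `L̃(w) (e[-1] ⊗ f) = e[1] ⊗ b(w) f + e[-1] ⊗ d(w) f`. -/
def bOp (τ η : ℂ) {n : ℕ} (Λ z : Fin n → ℂ) (w : ℂ) (f : ℂ → TensorSpace n) :
    ℂ → TensorSpace n :=
  entryOp τ η Λ z 1 (-1) w f

/-! ### The Bethe vector and the explicit formula -/

/-- The function `v(x) = e^{c x} ∏_{j=1}^m (θ(x - 2ηj) / θ(2η)) v_0`, where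
`v_0 = e_0 ⊗ ⋯ ⊗ e_0` is the highest weight vector. -/
def startVector (τ η : ℂ) (n m : ℕ) (c : ℂ) : ℂ → TensorSpace n :=
  fun x => Finsupp.single (fun _ => 0)
    (Complex.exp (c * x)
      * ∏ j ∈ Finset.Icc 1 m, (theta τ (x - 2 * η * (j : ℂ)) / theta τ (2 * η)))

/-- The Bethe vector `b(t_1) ⋯ b(t_m) v`. -/
def betheVector (τ η : ℂ) {n m : ℕ} (Λ z : Fin n → ℂ) (c : ℂ) (t : Fin m → ℂ) :
    ℂ → TensorSpace n :=
  (List.finRange m).foldr (fun i f => bOp τ η Λ z (t i) f) (startVector τ η n m c)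

/-- The ordered partitions `(I_1, …, I_n)` of `{1, …, m}` into `n` disjoint, possibly empty,
subsets. -/
def partitions (n m : ℕ) : Finset (Fin n → Finset (Fin m)) :=
  open Classical in Finset.univ.filter fun I => ∀ i, ∃! l, i ∈ I l

/-- The coefficient of `e_{m_1} ⊗ ⋯ ⊗ e_{m_n}` contributed by the partition `I`, where
`m_k = |I_k|`. -/
def betheCoeff (τ η : ℂ) {n m : ℕ} (Λ z : Fin n → ℂ) (t : Fin m → ℂ)
    (I : Fin n → Finset (Fin m)) (x : ℂ) : ℂ :=
  (∏ l, ∏ i ∈ I l, ∏ k ∈ Finset.Ioi l,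
      theta τ (t i - pPar η (Λ k) (z k)) / theta τ (t i - qPar η (Λ k) (z k)))
    * (∏ k, ∏ l ∈ Finset.Ioi k, ∏ i ∈ I k, ∏ j ∈ I l,
        theta τ (t i - t j - 2 * η) / theta τ (t i - t j))
    * ∏ k, ∏ j ∈ I k,
        theta τ (x + t j - qPar η (Λ k) (z k) + 2 * η * ((I k).card : ℂ)
            - 2 * η * ∑ l ∈ Finset.Ioi k, (Λ l - 2 * ((I l).card : ℂ)))
          / theta τ (t j - qPar η (Λ k) (z k))

/-- A `W`-valued function is entire if it takes its values in the span of finitely many basis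
vectors and its coordinates are entire functions. -/
def IsEntire {n : ℕ} (f : ℂ → TensorSpace n) : Prop :=
  (∃ S : Finset (Fin n → ℕ), ∀ x, (f x).support ⊆ S) ∧
    ∀ κ, Differentiable ℂ fun x => f x κ

end EllipticBethe

end

/-!
Split off the last tensor factor: `b(w)` of `W' ⊗ V_Λ(z)` is built from `a`, `b` on `W'` and `b`,
`d` on `V_Λ(z)`. Hence `b(t₁) ⋯ b(tₘ) v` is a sum over the sets `K` of variables which raise the
last factor, and it is natural to define a *weight vector* by this recursion and to show by
induction on the number of factors that `b(t₀)` adds the variable `t₀` to it. For this induction one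
also has to know `a(t₀)`, which yields a multiple of the weight vector and, for each variable `tᵢ`,
a term in which `tᵢ` is exchanged for `t₀`. Comparing coefficients, both claims become identities
for products of ratios `θ(s - tⱼ - 2η) / θ(s - tⱼ)`. These are partial fraction expansions in `s`,
and they follow from the three-term relation for `θ` by induction on the number of poles. The scalar
prefactors of `v` telescope under the shifts `λ ↦ λ + 2η`.

The denominators `θ(tᵢ - tⱼ)` and `θ(tⱼ - qₖ)` in the resulting formula do not depend on `λ`, so it
is entire, and `θ(t + 1) = -θ(t)` gives the multiplier under `λ ↦ λ + 1`.
-/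

noncomputable section

namespace EllipticBethe

open Filter Topology

/-! ### Theta functions -/

section Theta

variable {τ : ℂ}

/-- The general term of the series `-θ(t)`. -/
def thetaTerm (τ t : ℂ) (j : ℤ) : ℂ :=
  Complex.exp (Real.pi * Complex.I * ((j : ℂ) + 1 / 2) ^ 2 * τ
      + 2 * Real.pi * Complex.I * ((j : ℂ) + 1 / 2) * (t + 1 / 2))

lemma thetaTerm_eq_mul_jacobiTheta₂_term (τ t : ℂ) (j : ℤ) :
    thetaTerm τ t j = Complex.exp (Real.pi * Complex.I * (τ / 4 + t + 1 / 2))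
      * jacobiTheta₂_term j (t + 1 / 2 + τ / 2) τ := by
  rw [thetaTerm, jacobiTheta₂_term, ← Complex.exp_add]
  congr 1
  ring

lemma theta_eq_neg_exp_mul_jacobiTheta₂ (τ t : ℂ) :
    theta τ t = -(Complex.exp (Real.pi * Complex.I * (τ / 4 + t + 1 / 2))
      * jacobiTheta₂ (t + 1 / 2 + τ / 2) τ) := by
  rw [theta, jacobiTheta₂, ← tsum_mul_left]
  congr 1
  exact tsum_congr fun j => thetaTerm_eq_mul_jacobiTheta₂_term τ t j

lemma hasSum_thetaTerm (hτ : 0 < τ.im) (t : ℂ) : HasSum (thetaTerm τ t) (-theta τ t) := by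
  rw [theta_eq_neg_exp_mul_jacobiTheta₂, neg_neg]
  exact ((hasSum_jacobiTheta₂_term _ hτ).mul_left _).congr_fun
    (thetaTerm_eq_mul_jacobiTheta₂_term τ t)

lemma differentiable_theta (hτ : 0 < τ.im) : Differentiable ℂ (theta τ) := by
  have hJ : Differentiable ℂ fun t : ℂ => jacobiTheta₂ (t + 1 / 2 + τ / 2) τ := fun t =>
    (differentiableAt_jacobiTheta₂_fst (t + 1 / 2 + τ / 2) hτ).comp t
      (f := fun t : ℂ => t + 1 / 2 + τ / 2) (by fun_prop)
  rw [funext (theta_eq_neg_exp_mul_jacobiTheta₂ τ)]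
  fun_prop

lemma theta_add_one (τ t : ℂ) : theta τ (t + 1) = -theta τ t := by
  rw [theta_eq_neg_exp_mul_jacobiTheta₂, theta_eq_neg_exp_mul_jacobiTheta₂,
    show t + 1 + 1 / 2 + τ / 2 = t + 1 / 2 + τ / 2 + 1 by ring, jacobiTheta₂_add_left,
    show (Real.pi : ℂ) * Complex.I * (τ / 4 + (t + 1) + 1 / 2)
      = Real.pi * Complex.I * (τ / 4 + t + 1 / 2) + Real.pi * Complex.I by ring,
    Complex.exp_add, Complex.exp_pi_mul_I]
  ring

lemma theta_add_tau (τ t : ℂ) :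
    theta τ (t + τ) = -Complex.exp (-(Real.pi * Complex.I * (τ + 2 * t))) * theta τ t := by
  have h : Complex.exp (Real.pi * Complex.I) = -1 := Complex.exp_pi_mul_I
  rw [theta_eq_neg_exp_mul_jacobiTheta₂, theta_eq_neg_exp_mul_jacobiTheta₂,
    show t + τ + 1 / 2 + τ / 2 = t + 1 / 2 + τ / 2 + τ by ring, jacobiTheta₂_add_left']
  rw [show -(Real.pi : ℂ) * Complex.I * (τ + 2 * (t + 1 / 2 + τ / 2))
      = -(Real.pi * Complex.I * (τ + 2 * t)) + -(Real.pi * Complex.I * τ)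
        + -(Real.pi * Complex.I) by ring,
    show (Real.pi : ℂ) * Complex.I * (τ / 4 + (t + τ) + 1 / 2)
      = Real.pi * Complex.I * (τ / 4 + t + 1 / 2) + Real.pi * Complex.I * τ by ring]
  simp only [Complex.exp_add, Complex.exp_neg, h]
  field_simp

lemma theta_neg (τ t : ℂ) : theta τ (-t) = -theta τ t := by
  rw [theta_eq_neg_exp_mul_jacobiTheta₂, theta_eq_neg_exp_mul_jacobiTheta₂, ← jacobiTheta₂_neg_left,
    show -(-t + 1 / 2 + τ / 2) = (t - 1 / 2 - τ / 2) by ring]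
  have add_tau := jacobiTheta₂_add_left' (t - 1 / 2 - τ / 2) τ
  have add_one := jacobiTheta₂_add_left (t - 1 / 2 + τ / 2) τ
  rw [show t - 1 / 2 - τ / 2 + τ = t - 1 / 2 + τ / 2 by ring] at add_tau
  rw [show t - 1 / 2 + τ / 2 + 1 = t + 1 / 2 + τ / 2 by ring] at add_one
  rw [add_one, add_tau, ← mul_assoc, ← Complex.exp_add,
    show (Real.pi : ℂ) * Complex.I * (τ / 4 + t + 1 / 2)
      + -Real.pi * Complex.I * (τ + 2 * (t - 1 / 2 - τ / 2))
      = Real.pi * Complex.I * (τ / 4 + -t + 1 / 2) + Real.pi * Complex.I by ring,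
    Complex.exp_add _ (Real.pi * Complex.I), Complex.exp_pi_mul_I]
  ring

lemma theta_sub_comm (τ a b : ℂ) : theta τ (a - b) = -theta τ (b - a) := by
  rw [← theta_neg, neg_sub]

lemma theta_sub_ne_zero_comm {a b : ℂ} : theta τ (a - b) ≠ 0 ↔ theta τ (b - a) ≠ 0 := by
  rw [theta_sub_comm, neg_ne_zero]

lemma theta_zero (τ : ℂ) : theta τ 0 = 0 :=
  self_eq_neg.mp <| by simpa only [neg_zero] using theta_neg τ 0

/-- The bijection `(u, v) ↦ (u + v, u - v - 1)`, `(u, v) ↦ (u + v, u - v)` between two copies of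
`ℤ × ℤ` and the pairs of integers with an odd, respectively an even, sum. It sorts the terms of a
product of two theta series. -/
def parityEquiv : (ℤ × ℤ) ⊕ (ℤ × ℤ) ≃ ℤ × ℤ where
  toFun := Sum.elim (fun u => (u.1 + u.2, u.1 - u.2 - 1)) (fun u => (u.1 + u.2, u.1 - u.2))
  invFun p := if Even (p.1 + p.2) then Sum.inr ((p.1 + p.2) / 2, (p.1 - p.2) / 2)
    else Sum.inl ((p.1 + p.2 + 1) / 2, (p.1 - p.2 - 1) / 2)
  left_inv := by
    rintro (⟨u, v⟩ | ⟨u, v⟩)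
    · have h : ¬ Even (u + v + (u - v - 1)) := by rw [Int.even_iff]; lia
      simp only [Sum.elim_inl, h, if_false, Sum.inl.injEq, Prod.mk.injEq]
      lia
    · have h : Even (u + v + (u - v)) := by rw [Int.even_iff]; lia
      simp only [Sum.elim_inr, h, if_true, Sum.inr.injEq, Prod.mk.injEq]
      lia
  right_inv := by
    rintro ⟨j, k⟩
    by_cases h : Even (j + k)
    · simp only [h, if_true, Sum.elim_inr, Prod.mk.injEq]
      rw [Int.even_iff] at h
      lia
    · simp only [h, if_false, Sum.elim_inl, Prod.mk.injEq]
      rw [Int.even_iff] at h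
      lia

/-- The part of the theta series of modulus `τ / 2` indexed by even integers. -/
def thetaEven (τ x : ℂ) : ℂ := jacobiTheta₂ (2 * x) (2 * τ)

/-- The part of the theta series of modulus `τ / 2` indexed by odd integers. -/
def thetaOdd (τ x : ℂ) : ℂ :=
  Complex.exp (Real.pi * Complex.I * τ / 2 + 2 * Real.pi * Complex.I * x)
    * jacobiTheta₂ (2 * x + τ) (2 * τ)

lemma hasSum_thetaEven (hτ : 0 < τ.im) (x : ℂ) :
    HasSum (fun u : ℤ => Complex.exp (Real.pi * Complex.I * τ * (2 * u) ^ 2 / 2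
      + 2 * Real.pi * Complex.I * (2 * u) * x)) (thetaEven τ x) := by
  have h2 : 0 < (2 * τ).im := by simpa using hτ
  refine (hasSum_jacobiTheta₂_term (2 * x) h2).congr_fun fun u => ?_
  rw [jacobiTheta₂_term]
  congr 1
  ring

lemma hasSum_thetaOdd (hτ : 0 < τ.im) (x : ℂ) :
    HasSum (fun u : ℤ => Complex.exp (Real.pi * Complex.I * τ * (2 * u + 1) ^ 2 / 2
      + 2 * Real.pi * Complex.I * (2 * u + 1) * x)) (thetaOdd τ x) := by
  have h2 : 0 < (2 * τ).im := by simpa using hτ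
  refine ((hasSum_jacobiTheta₂_term (2 * x + τ) h2).mul_left _).congr_fun fun u => ?_
  rw [jacobiTheta₂_term, ← Complex.exp_add]
  congr 1
  ring

lemma hasSum_mul_prod {ι κ : Type*} {f : ι → ℂ} {g : κ → ℂ} {a b : ℂ} (hf : HasSum f a)
    (hg : HasSum g b) : HasSum (fun p : ι × κ => f p.1 * g p.2) (a * b) :=
  hf.mul hg (summable_mul_of_summable_norm hf.summable.norm hg.summable.norm)

lemma theta_add_mul_theta_sub (hτ : 0 < τ.im) (x y : ℂ) :
    theta τ (x + y) * theta τ (x - y)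
      = thetaEven τ x * thetaOdd τ y - thetaOdd τ x * thetaEven τ y := by
  have product := hasSum_mul_prod (hasSum_thetaTerm hτ (x + y)) (hasSum_thetaTerm hτ (x - y))
  rw [neg_mul_neg, ← parityEquiv.hasSum_iff] at product
  have odd_pairs := hasSum_mul_prod (hasSum_thetaEven hτ x) (hasSum_thetaOdd hτ y)
  have even_pairs := (hasSum_mul_prod (hasSum_thetaOdd hτ x) (hasSum_thetaEven hτ y)).neg
  rw [sub_eq_add_neg]
  refine product.unique (HasSum.sum (odd_pairs.congr_fun ?_) (even_pairs.congr_fun ?_))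
  · rintro ⟨u, v⟩
    simp only [Function.comp_apply, parityEquiv, Equiv.coe_fn_mk, Sum.elim_inl, thetaTerm,
      ← Complex.exp_add]
    rw [Complex.exp_eq_exp_iff_exists_int]
    refine ⟨u, ?_⟩
    push_cast
    ring
  · rintro ⟨u, v⟩
    simp only [Function.comp_apply, parityEquiv, Equiv.coe_fn_mk, Sum.elim_inr, thetaTerm,
      ← Complex.exp_add]
    rw [neg_eq_neg_one_mul, ← Complex.exp_pi_mul_I, ← Complex.exp_add,
      Complex.exp_eq_exp_iff_exists_int]
    refine ⟨u, ?_⟩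
    push_cast
    ring

/-- Weierstrass's three-term identity, written without halves in the arguments. -/
lemma theta_three_term (hτ : 0 < τ.im) (p d e f : ℂ) :
    theta τ (p + d) * theta τ (p + e) * (theta τ f * theta τ (f + d + e))
      = theta τ p * theta τ (p + d + e) * (theta τ (f + d) * theta τ (f + e))
        - theta τ (p - f) * theta τ (p + f + d + e) * (theta τ d * theta τ e) := by
  have symmetric_form (x y u v : ℂ) :
      theta τ (x + y) * theta τ (x - y) * (theta τ (u + v) * theta τ (u - v))
        = theta τ (x + v) * theta τ (x - v) * (theta τ (u + y) * theta τ (u - y))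
          - theta τ (x + u) * theta τ (x - u) * (theta τ (v + y) * theta τ (v - y)) := by
    simp only [theta_add_mul_theta_sub hτ]
    ring
  have h := symmetric_form (p + (d + e) / 2) ((d - e) / 2) (f + (d + e) / 2) ((d + e) / 2)
  ring_nf at h ⊢
  linear_combination h

end Theta

section Codiscrete

variable {X Y : Type*} [TopologicalSpace X] [TopologicalSpace Y]

lemma eventually_codiscrete_iff {p : X → Prop} :
    (∀ᶠ x in codiscrete X, p x) ↔ ∀ x, ∀ᶠ y in 𝓝[≠] x, p y := by
  simp only [Filter.Eventually, mem_codiscrete, disjoint_principal_right, compl_compl]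

lemma exists_of_eventually_codiscrete {p : X → Prop} (h : ∀ᶠ x in codiscrete X, p x) (x : X)
    [(𝓝[≠] x).NeBot] : ∃ y, p y :=
  (eventually_codiscrete_iff.mp h x).exists

lemma tendsto_codiscrete_of_injective {f : X → Y} (hf : Continuous f)
    (hinj : Function.Injective f) : Tendsto f (codiscrete X) (codiscrete Y) := fun _ hs =>
  eventually_codiscrete_iff.mpr fun x =>
    (tendsto_nhdsWithin_of_tendsto_nhds_of_eventually_within f
      (hf.continuousAt.tendsto.mono_left nhdsWithin_le_nhds)
      (eventually_mem_nhdsWithin.mono fun _ hy => hinj.ne hy)).eventually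
      (eventually_codiscrete_iff.mp hs (f x))

lemma tendsto_add_right_codiscrete {G : Type*} [TopologicalSpace G] [AddGroup G]
    [ContinuousAdd G] (a : G) : Tendsto (· + a) (codiscrete G) (codiscrete G) :=
  tendsto_codiscrete_of_injective (by fun_prop) (add_left_injective a)

lemma eq_of_eventuallyEq_codiscrete [T2Space Y] {f g : X → Y} {x : X} [(𝓝[≠] x).NeBot]
    (hf : ContinuousAt f x) (hg : ContinuousAt g x) (h : f =ᶠ[codiscrete X] g) : f x = g x :=
  ((hf.eventuallyEq_nhds_iff_eventuallyEq_nhdsNE hg).mp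
    (eventually_codiscrete_iff.mp h x)).eq_of_nhds

end Codiscrete

section ZerosOfTheta

variable {τ : ℂ}

lemma integral_jacobiTheta₂_term (τ : ℂ) (n : ℤ) :
    ∫ x in (0 : ℝ)..1, jacobiTheta₂_term n x τ = if n = 0 then 1 else 0 := by
  split_ifs with hn
  · simp [jacobiTheta₂_term, hn]
  · have hc : 2 * Real.pi * Complex.I * n ≠ 0 := by
      simp [hn, Real.pi_ne_zero]
    simp only [jacobiTheta₂_term, Complex.exp_add, intervalIntegral.integral_mul_const,
      integral_exp_mul_complex hc]
    have : Complex.exp (2 * Real.pi * Complex.I * n * (1 : ℝ)) = 1 := by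
      rw [Complex.exp_eq_one_iff]
      exact ⟨n, by push_cast; ring⟩
    rw [this]
    simp

lemma integral_jacobiTheta₂ (hτ : 0 < τ.im) :
    ∫ x in (0 : ℝ)..1, jacobiTheta₂ x τ = 1 := by
  have h : HasSum (fun n : ℤ => ∫ x in (0 : ℝ)..1, jacobiTheta₂_term n x τ)
      (∫ x in (0 : ℝ)..1, jacobiTheta₂ x τ) := by
    refine intervalIntegral.hasSum_integral_of_dominated_convergence
      (fun n _ => ‖jacobiTheta₂_term n 0 τ‖) (fun n => ?_) (fun n => ?_) ?_ ?_ ?_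
    · apply Continuous.aestronglyMeasurable
      unfold jacobiTheta₂_term
      fun_prop
    · refine Eventually.of_forall fun x _ => le_of_eq ?_
      rw [norm_jacobiTheta₂_term, norm_jacobiTheta₂_term]
      simp
    · exact Eventually.of_forall fun x _ => (hasSum_jacobiTheta₂_term 0 hτ).summable.norm
    · exact intervalIntegrable_const
    · exact Eventually.of_forall fun x _ => hasSum_jacobiTheta₂_term x hτ
  simp only [integral_jacobiTheta₂_term] at h
  exact h.unique (hasSum_ite_eq 0 1)

lemma exists_theta_ne_zero (hτ : 0 < τ.im) : ∃ x, theta τ x ≠ 0 := by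
  by_contra! h
  have jacobi_eq_zero (x : ℝ) : jacobiTheta₂ x τ = 0 := by
    have := h (x - 1 / 2 - τ / 2)
    rw [theta_eq_neg_exp_mul_jacobiTheta₂, neg_eq_zero,
      mul_eq_zero_iff_left (Complex.exp_ne_zero _)] at this
    convert this using 2
    ring
  simpa [jacobi_eq_zero] using integral_jacobiTheta₂ hτ

lemma eventually_theta_add_ne_zero (hτ : 0 < τ.im) (a : ℂ) :
    ∀ᶠ x in codiscrete ℂ, theta τ (x + a) ≠ 0 := by
  obtain ⟨x₀, hx₀⟩ := exists_theta_ne_zero hτ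
  exact (tendsto_add_right_codiscrete a).eventually
    ((Complex.analyticOnNhd_univ_iff_differentiable.mpr
      (differentiable_theta hτ)).preimage_zero_mem_codiscrete hx₀)

lemma eventually_theta_sub_ne_zero (hτ : 0 < τ.im) (a : ℂ) :
    ∀ᶠ x in codiscrete ℂ, theta τ (x - a) ≠ 0 := by
  simpa only [sub_eq_add_neg] using eventually_theta_add_ne_zero hτ (-a)

lemma eventually_theta_ne_zero (hτ : 0 < τ.im) : ∀ᶠ x in codiscrete ℂ, theta τ x ≠ 0 := by
  simpa only [add_zero] using eventually_theta_add_ne_zero hτ 0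

lemma eq_const_mul_exp_of_wronskian {f g : ℂ → ℂ} (hf : Differentiable ℂ f)
    (hg : Differentiable ℂ g) {x₀ : ℂ} (hx : g x₀ ≠ 0) (α : ℂ)
    (h : ∀ x, deriv f x * g x - f x * deriv g x = α * (f x * g x)) :
    ∃ C, ∀ x, f x = C * Complex.exp (α * x) * g x := by
  obtain ⟨r, hr, hball⟩ := Metric.eventually_nhds_iff_ball.mp
    (hg.continuous.continuousAt.eventually_ne hx)
  let φ : ℂ → ℂ := fun x => f x / (Complex.exp (α * x) * g x)
  have hne : ∀ x ∈ Metric.ball x₀ r, Complex.exp (α * x) * g x ≠ 0 := fun x hx =>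
    mul_ne_zero (Complex.exp_ne_zero _) (hball x hx)
  have hd : ∀ x ∈ Metric.ball x₀ r, HasDerivAt φ 0 x := fun x hx => by
    have he : HasDerivAt (fun x : ℂ => Complex.exp (α * x)) (Complex.exp (α * x) * α) x := by
      simpa using ((hasDerivAt_id x).const_mul α).cexp
    have := (hf x).hasDerivAt.div (he.mul (hg x).hasDerivAt) (hne x hx)
    refine this.congr_deriv ?_
    rw [div_eq_zero_iff]
    left
    simp only [Pi.mul_apply]
    linear_combination Complex.exp (α * x) * h x
  have hconst : ∀ x ∈ Metric.ball x₀ r, φ x = φ x₀ := fun x hx =>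
    Metric.isOpen_ball.is_const_of_deriv_eq_zero (convex_ball x₀ r).isPreconnected
      (fun y hy => (hd y hy).differentiableAt.differentiableWithinAt)
      (fun y hy => (hd y hy).deriv) hx (Metric.mem_ball_self hr)
  refine ⟨φ x₀, fun x => ?_⟩
  have hev : f =ᶠ[𝓝 x₀] fun x => φ x₀ * Complex.exp (α * x) * g x := by
    filter_upwards [Metric.ball_mem_nhds x₀ hr] with y hy
    rw [← hconst y hy, mul_assoc]
    exact (div_mul_cancel₀ _ (hne y hy)).symm
  exact congr_fun ((Complex.analyticOnNhd_univ_iff_differentiable.mpr hf).eq_of_eventuallyEq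
    (Complex.analyticOnNhd_univ_iff_differentiable.mpr (by fun_prop)) hev) x

lemma theta_cross_ratio_of_theta_eq_zero (hτ : 0 < τ.im) {a : ℂ} (ha : theta τ a = 0)
    (p q s : ℂ) :
    theta τ (p + s) * theta τ q * (theta τ (p - a) * theta τ (q - a + s))
      = theta τ p * theta τ (q + s) * (theta τ (p - a + s) * theta τ (q - a)) := by
  have h := theta_three_term hτ (a - q) q (p - a) s
  rw [show a - q + q = a by ring, ha, show a + (p - a) = p by ring,
    show a - q - s = -(q - a + s) by ring, show a - q + s + q + (p - a) = p + s by ring,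
    theta_neg, theta_sub_comm τ a q] at h
  rw [show q + s = s + q by ring, show p - a + s = s + (p - a) by ring]
  linear_combination -h

lemma wronskian_theta_cross_mul (hτ : 0 < τ.im) {a : ℂ} (ha : theta τ a = 0) (p q : ℂ) :
    (deriv (theta τ) p * theta τ (p - a) - theta τ p * deriv (theta τ) (p - a))
        * (theta τ q * theta τ (q - a))
      = (deriv (theta τ) q * theta τ (q - a) - theta τ q * deriv (theta τ) (q - a))
        * (theta τ p * theta τ (p - a)) := by
  have hd (b : ℂ) : HasDerivAt (fun s => theta τ (b + s)) (deriv (theta τ) b) 0 :=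
    HasDerivAt.comp_const_add b 0 (by rw [add_zero]; exact (differentiable_theta hτ b).hasDerivAt)
  have deriv_left :=
    ((hd p).mul_const (theta τ q)).mul ((hd (q - a)).const_mul (theta τ (p - a)))
  have deriv_right :=
    ((hd q).const_mul (theta τ p)).mul ((hd (p - a)).mul_const (theta τ (q - a)))
  have hfun : (fun s => theta τ (p + s) * theta τ q)
        * (fun s => theta τ (p - a) * theta τ (q - a + s))
      = (fun s => theta τ p * theta τ (q + s))
        * fun s => theta τ (p - a + s) * theta τ (q - a) :=
    funext (theta_cross_ratio_of_theta_eq_zero hτ ha p q)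
  have h := (hfun ▸ deriv_left).unique deriv_right
  simp only [add_zero] at h
  linear_combination h

lemma exists_theta_eq_exp_mul_theta_sub (hτ : 0 < τ.im) {a : ℂ} (ha : theta τ a = 0) :
    ∃ C α, ∀ x, theta τ x = C * Complex.exp (α * x) * theta τ (x - a) := by
  obtain ⟨q, hq, hqa⟩ := exists_of_eventually_codiscrete
    ((eventually_theta_ne_zero hτ).and (eventually_theta_sub_ne_zero hτ a)) 0
  have hdiff := differentiable_theta hτ
  let α := (deriv (theta τ) q * theta τ (q - a) - theta τ q * deriv (theta τ) (q - a))
    / (theta τ q * theta τ (q - a))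
  obtain ⟨C, hC⟩ := eq_const_mul_exp_of_wronskian hdiff
    (g := fun x => theta τ (x - a)) (by fun_prop) hqa α fun x => by
      rw [deriv_comp_sub_const, div_mul_eq_mul_div, eq_div_iff (mul_ne_zero hq hqa)]
      exact wronskian_theta_cross_mul hτ ha x q
  exact ⟨C, α, hC⟩

/-- If `θ(a) = 0`, then `θ(x) = C exp (α x) θ(x - a)`, and the quasi-periods of the two sides
differ unless `a` is in the lattice. -/
lemma mem_lattice_of_theta_eq_zero (hτ : 0 < τ.im) {a : ℂ} (ha : theta τ a = 0) :
    a ∈ lattice τ := by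
  obtain ⟨C, α, hC⟩ := exists_theta_eq_exp_mul_theta_sub hτ ha
  obtain ⟨q, hq⟩ := exists_theta_ne_zero hτ
  have exp_α : Complex.exp α = 1 := by
    have h := hC (q + 1)
    rw [add_sub_right_comm, theta_add_one, theta_add_one, mul_add, mul_one, Complex.exp_add] at h
    refine mul_left_cancel₀ hq ?_
    linear_combination Complex.exp α * hC q + h
  have exp_ατ : Complex.exp (α * τ + 2 * Real.pi * Complex.I * a) = 1 := by
    have h := hC (q + τ)
    rw [add_sub_right_comm, theta_add_tau, theta_add_tau, mul_add α, Complex.exp_add,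
      show -(Real.pi * Complex.I * (τ + 2 * (q - a)))
        = -(Real.pi * Complex.I * (τ + 2 * q)) + 2 * Real.pi * Complex.I * a by ring,
      Complex.exp_add (-_)] at h
    rw [Complex.exp_add]
    refine mul_left_cancel₀
      (mul_ne_zero (Complex.exp_ne_zero (-(Real.pi * Complex.I * (τ + 2 * q)))) hq) ?_
    linear_combination Complex.exp (-(Real.pi * Complex.I * (τ + 2 * q)))
      * Complex.exp (α * τ) * Complex.exp (2 * Real.pi * Complex.I * a) * hC q + h
  obtain ⟨k, hk⟩ := Complex.exp_eq_one_iff.mp exp_α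
  obtain ⟨l, hl⟩ := Complex.exp_eq_one_iff.mp exp_ατ
  refine ⟨l, -k, mul_left_cancel₀ Complex.two_pi_I_ne_zero ?_⟩
  rw [hk] at hl
  push_cast
  linear_combination hl

lemma theta_ne_zero (hτ : 0 < τ.im) {a : ℂ} (ha : a ∉ lattice τ) : theta τ a ≠ 0 :=
  fun h => ha (mem_lattice_of_theta_eq_zero hτ h)

end ZerosOfTheta

/-! ### Partial fractions -/

section PartialFractions

variable {κ : Type*} {τ : ℂ}

lemma pairwise_insertNone {S : Finset κ} {x : Option κ → ℂ}
    (hx : (S : Set κ).Pairwise fun i j => theta τ (x (some i) - x (some j)) ≠ 0)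
    (h : ∀ i ∈ S, theta τ (x (some i) - x none) ≠ 0) :
    (Finset.insertNone S : Set (Option κ)).Pairwise fun i j => theta τ (x i - x j) ≠ 0 := by
  rintro (_ | i) hi (_ | j) hj hij
  · exact absurd rfl hij
  · exact theta_sub_ne_zero_comm.mp (h j (by simpa using hj))
  · exact h i (by simpa using hi)
  · exact hx (by simpa using hi) (by simpa using hj) (fun h => hij (congrArg some h))

variable [DecidableEq κ]

@[to_additive]
lemma prod_update_update {M α : Type*} [CommMonoid M] {S : Finset κ} {a b : κ} (ha : a ∈ S)
    (hb : b ∈ S) (hab : a ≠ b) (F : α → M) (y : κ → α) (u v : α) :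
    ∏ i ∈ S, F (Function.update (Function.update y a u) b v i)
      = F u * F v * ∏ i ∈ (S.erase b).erase a, F (y i) := by
  rw [← Finset.mul_prod_erase S _ hb, ← Finset.mul_prod_erase _ _ (Finset.mem_erase.mpr ⟨hab, ha⟩),
    Function.update_self, Function.update_of_ne hab, Function.update_self, mul_assoc,
    mul_left_comm]
  refine congrArg (F u * ·) (congrArg (F v * ·) (Finset.prod_congr rfl fun i hi => ?_))
  simp only [Finset.mem_erase] at hi
  rw [Function.update_of_ne hi.2.1, Function.update_of_ne hi.1]

lemma sum_update_update_eq {S : Finset κ} {a b : κ} (ha : a ∈ S) (hb : b ∈ S) (hab : a ≠ b)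
    (y : κ → ℂ) {u v : ℂ} (huv : u + v = y a + y b) :
    ∑ i ∈ S, Function.update (Function.update y a u) b v i = ∑ i ∈ S, y i := by
  have h := sum_update_update ha hb hab id y
  have hy := h (y a) (y b)
  simp only [id_eq, Function.update_eq_self] at h hy
  rw [h, hy, huv]

/-- The residue at `x_j`, up to a factor independent of `j`, of the function
`∏_{i ∈ S} θ(u - y_i) / θ(u - x_i)` of `u`. -/
def thetaResidue (τ : ℂ) (S : Finset κ) (x y : κ → ℂ) (j : κ) : ℂ :=
  (∏ i ∈ S, theta τ (x j - y i)) / ∏ i ∈ S.erase j, theta τ (x j - x i)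

variable {S : Finset κ} {x y : κ → ℂ}

lemma sum_thetaResidue_erase (hx : (S : Set κ).Pairwise fun i j => theta τ (x i - x j) ≠ 0)
    {b : κ} (hb : b ∈ S) (hy : y b = x b) :
    ∑ j ∈ S, thetaResidue τ S x y j = ∑ j ∈ S.erase b, thetaResidue τ (S.erase b) x y j := by
  have residue_b : thetaResidue τ S x y b = 0 := by
    rw [thetaResidue, Finset.prod_eq_zero hb (by rw [hy, sub_self, theta_zero]), zero_div]
  rw [← Finset.add_sum_erase S _ hb, residue_b, zero_add]
  refine Finset.sum_congr rfl fun j hj => ?_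
  obtain ⟨hjb, hjS⟩ := Finset.mem_erase.mp hj
  rw [thetaResidue, thetaResidue, ← Finset.mul_prod_erase S _ hb,
    ← Finset.mul_prod_erase (S.erase j) _ (Finset.mem_erase.mpr ⟨hjb.symm, hb⟩), hy,
    Finset.erase_right_comm, mul_div_mul_left _ _ (hx hjS hb hjb)]

lemma sum_thetaResidue_update_mul (hτ : 0 < τ.im) (x y : κ → ℂ) {a b : κ} (ha : a ∈ S)
    (hb : b ∈ S) (hab : a ≠ b) :
    theta τ (x a + x b - (y a + y b)) * theta τ (x a - x b) * ∑ j ∈ S, thetaResidue τ S x y j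
      = theta τ (x a - y b) * theta τ (x a - y a) * ∑ j ∈ S, thetaResidue τ S x
          (Function.update (Function.update y a (y a + y b - x b)) b (x b)) j
        - theta τ (x b - y b) * theta τ (x b - y a) * ∑ j ∈ S, thetaResidue τ S x
          (Function.update (Function.update y a (x a)) b (y a + y b - x a)) j := by
  simp only [thetaResidue, Finset.mul_sum, ← Finset.sum_sub_distrib]
  refine Finset.sum_congr rfl fun j _ => ?_
  have split (u v : ℂ) := prod_update_update ha hb hab (fun w => theta τ (x j - w)) y u v
  have split_y := split (y a) (y b)
  rw [Function.update_eq_self, Function.update_eq_self] at split_y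
  rw [split_y, split, split]
  have h := theta_three_term hτ (x j - x b) (x b - y b) (x b - y a) (x a - x b)
  rw [show x j - x b + (x b - y b) + (x b - y a) = x j - (y a + y b - x b) by ring,
    show x j - x b + (x b - y b) = x j - y b by ring,
    show x j - x b + (x b - y a) = x j - y a by ring,
    show x a - x b + (x b - y b) + (x b - y a) = x a + x b - (y a + y b) by ring,
    show x a - x b + (x b - y b) = x a - y b by ring,
    show x a - x b + (x b - y a) = x a - y a by ring,
    show x j - x b - (x a - x b) = x j - x a by ring,
    show x j - x b + (x a - x b) + (x b - y b) + (x b - y a) = x j - (y a + y b - x a) by ring]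
    at h
  simp only [div_eq_mul_inv]
  linear_combination (∏ i ∈ (S.erase b).erase a, theta τ (x j - y i))
    * (∏ i ∈ S.erase j, theta τ (x j - x i))⁻¹ * h

lemma sum_thetaResidue_eq_zero_of_erase (hτ : 0 < τ.im)
    (hx : (S : Set κ).Pairwise fun i j => theta τ (x i - x j) ≠ 0)
    (ih : ∀ b ∈ S, ∀ z : κ → ℂ, ∑ i ∈ S.erase b, x i = ∑ i ∈ S.erase b, z i →
      ∑ j ∈ S.erase b, thetaResidue τ (S.erase b) x z j = 0)
    (hsum : ∑ i ∈ S, x i = ∑ i ∈ S, y i) {a b : κ} (ha : a ∈ S) (hb : b ∈ S) (hab : a ≠ b)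
    (hne : theta τ (x a + x b - (y a + y b)) ≠ 0) : ∑ j ∈ S, thetaResidue τ S x y j = 0 := by
  have shared_node (z : κ → ℂ) {c : κ} (hc : c ∈ S) (hz : z c = x c)
      (hs : ∑ i ∈ S, x i = ∑ i ∈ S, z i) : ∑ j ∈ S, thetaResidue τ S x z j = 0 := by
    rw [sum_thetaResidue_erase hx hc hz]
    refine ih c hc z ?_
    rw [← Finset.add_sum_erase S _ hc, ← Finset.add_sum_erase S z hc, hz] at hs
    exact add_left_cancel hs
  have h := sum_thetaResidue_update_mul hτ x y ha hb hab
  rw [shared_node _ hb (Function.update_self ..)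
      (hsum.trans (sum_update_update_eq ha hb hab y (by ring)).symm),
    shared_node _ ha (by rw [Function.update_of_ne hab, Function.update_self])
      (hsum.trans (sum_update_update_eq ha hb hab y (by ring)).symm),
    mul_zero, mul_zero, sub_zero] at h
  exact (mul_eq_zero.mp h).resolve_left (mul_ne_zero hne (hx ha hb hab))

lemma sum_thetaResidue_pair_eq_zero (τ : ℂ) {x y : κ → ℂ} {a b : κ} (hab : a ≠ b)
    (hsum : x a + x b = y a + y b) : ∑ j ∈ {a, b}, thetaResidue τ {a, b} x y j = 0 := by
  have erase_left : ({a, b} : Finset κ).erase a = {b} :=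
    Finset.erase_insert (Finset.notMem_singleton.mpr hab)
  have erase_right : ({a, b} : Finset κ).erase b = {a} := by
    rw [Finset.pair_comm, Finset.erase_insert (Finset.notMem_singleton.mpr hab.symm)]
  simp only [thetaResidue, Finset.sum_pair hab, Finset.prod_pair hab, erase_left, erase_right,
    Finset.prod_singleton]
  rw [theta_sub_comm τ (x b) (x a), show x a - y a = -(x b - y b) by linear_combination hsum,
    show x a - y b = -(x b - y a) by linear_combination hsum, theta_neg, theta_neg, div_neg]
  ring

-- Moving two zeros in opposite directions makes the theta factor in the recursion nonzero.
lemma sum_thetaResidue_eq_zero_of_two_lt_card (hτ : 0 < τ.im) (hS : 2 < S.card)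
    (hx : (S : Set κ).Pairwise fun i j => theta τ (x i - x j) ≠ 0)
    (ih : ∀ b ∈ S, ∀ z : κ → ℂ, ∑ i ∈ S.erase b, x i = ∑ i ∈ S.erase b, z i →
      ∑ j ∈ S.erase b, thetaResidue τ (S.erase b) x z j = 0)
    (hsum : ∑ i ∈ S, x i = ∑ i ∈ S, y i) : ∑ j ∈ S, thetaResidue τ S x y j = 0 := by
  obtain ⟨a, ha, b, hb, c, hc, hab, hac, hbc⟩ := Finset.two_lt_card.mp hS
  let z (e : ℂ) : κ → ℂ := Function.update (Function.update y a (y a + e)) c (y c - e)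
  have z_zero : z 0 = y := by simp [z]
  have continuous_sum : Continuous fun e => ∑ j ∈ S, thetaResidue τ S x (z e) j := by
    have split (e : ℂ) (j : κ) :=
      prod_update_update ha hc hac (fun w => theta τ (x j - w)) y (y a + e) (y c - e)
    simp only [thetaResidue, z, split]
    have := (differentiable_theta hτ).continuous
    fun_prop
  have sum_eventuallyEq :
      (fun e => ∑ j ∈ S, thetaResidue τ S x (z e) j) =ᶠ[codiscrete ℂ] fun _ => 0 := by
    filter_upwards [eventually_theta_sub_ne_zero hτ (x a + x b - (y a + y b))] with e he
    refine sum_thetaResidue_eq_zero_of_erase hτ hx ih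
      (hsum.trans (sum_update_update_eq ha hc hac y (by ring)).symm) ha hb hab ?_
    simp only [z]
    rw [Function.update_of_ne hac, Function.update_self, Function.update_of_ne hbc,
      Function.update_of_ne hab.symm]
    convert theta_sub_ne_zero_comm.mp he using 2
    ring
  simpa only [z_zero] using eq_of_eventuallyEq_codiscrete (x := 0) continuous_sum.continuousAt
    continuousAt_const sum_eventuallyEq

theorem sum_thetaResidue_eq_zero (hτ : 0 < τ.im)
    (hx : (S : Set κ).Pairwise fun i j => theta τ (x i - x j) ≠ 0)
    (hsum : ∑ i ∈ S, x i = ∑ i ∈ S, y i) : ∑ j ∈ S, thetaResidue τ S x y j = 0 := by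
  induction S using Finset.strongInduction generalizing y with
  | H S ih =>
    rcases lt_or_ge 2 S.card with hS | hS
    · exact sum_thetaResidue_eq_zero_of_two_lt_card hτ hS hx (fun b hb z hz =>
        ih _ (Finset.erase_ssubset hb) (hx.mono (Finset.erase_subset b S)) hz) hsum
    interval_cases hcard : S.card
    · rw [Finset.card_eq_zero.mp hcard, Finset.sum_empty]
    · obtain ⟨a, rfl⟩ := Finset.card_eq_one.mp hcard
      rw [Finset.sum_singleton, Finset.sum_singleton] at hsum
      rw [Finset.sum_singleton, thetaResidue, Finset.prod_singleton, hsum, sub_self, theta_zero,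
        zero_div]
    · obtain ⟨a, b, hab, rfl⟩ := Finset.card_eq_two.mp hcard
      rw [Finset.sum_pair hab, Finset.sum_pair hab] at hsum
      exact sum_thetaResidue_pair_eq_zero τ hab hsum

lemma insertNone_erase_some (S : Finset κ) (j : κ) :
    (Finset.insertNone S).erase (some j) = Finset.insertNone (S.erase j) := by
  ext (_ | i) <;> simp

lemma insertNone_erase_none (S : Finset κ) :
    (Finset.insertNone S).erase none = S.map Function.Embedding.some := by
  ext (_ | i) <;> simp

lemma thetaResidue_insertNone_some (τ : ℂ) (S : Finset κ) (x y : Option κ → ℂ) (j : κ) :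
    thetaResidue τ (Finset.insertNone S) x y (some j)
      = theta τ (x (some j) - y none) / theta τ (x (some j) - x none)
        * thetaResidue τ S (fun i => x (some i)) (fun i => y (some i)) j := by
  rw [thetaResidue, thetaResidue, insertNone_erase_some, Finset.prod_insertNone,
    Finset.prod_insertNone, mul_div_mul_comm]

lemma thetaResidue_insertNone_none (τ : ℂ) (S : Finset κ) (x y : Option κ → ℂ) :
    thetaResidue τ (Finset.insertNone S) x y none
      = theta τ (x none - y none)
        * ∏ i ∈ S, theta τ (x none - y (some i)) / theta τ (x none - x (some i)) := by
  rw [thetaResidue, insertNone_erase_none, Finset.prod_insertNone, Finset.prod_map,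
    Finset.prod_div_distrib, mul_div_assoc]
  rfl

/-- The ratio `θ(a - b - g) / θ(a - b)` attached to an ordered pair `a, b` of spectral parameters;
at `g = 2η` it is the factor of the Bethe vector contributed by `a = t_i` and `b = t_j`. -/
def shiftRatio (τ g a b : ℂ) : ℂ := theta τ (a - b - g) / theta τ (a - b)

lemma shiftRatio_swap (τ g a b : ℂ) :
    shiftRatio τ g a b = theta τ (b - a + g) / theta τ (b - a) := by
  rw [shiftRatio, show a - b - g = -(b - a + g) by ring, theta_sub_comm τ a b, theta_neg,
    neg_div_neg_eq]

lemma partial_fraction_shift (hτ : 0 < τ.im) {K : Finset κ} {t : κ → ℂ} {u v p r h : ℂ}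
    (ht : (K : Set κ).Pairwise fun i j => theta τ (t i - t j) ≠ 0)
    (hu : ∀ j ∈ K, theta τ (t j - u) ≠ 0) (hv : ∀ j ∈ K, theta τ (t j - v) ≠ 0)
    (huv : theta τ (u - v) ≠ 0) (hsum : u + v = p + r + h * K.card) :
    ∑ j ∈ K, theta τ h * theta τ (t j - p) * theta τ (t j - r)
        / (theta τ (t j - u) * theta τ (t j - v))
        * ∏ i ∈ K.erase j, shiftRatio τ h (t j) (t i)
      = theta τ (u - p) * theta τ (u - r) / theta τ (u - v)
          * ∏ i ∈ K, shiftRatio τ h u (t i)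
        - theta τ (v - p) * theta τ (v - r) / theta τ (u - v)
          * ∏ i ∈ K, shiftRatio τ h v (t i) := by
  let x : Option (Option κ) → ℂ := fun o => o.elim u fun o => o.elim v t
  let y : Option (Option κ) → ℂ := fun o => o.elim p fun o => o.elim r fun i => t i + h
  have sum_residues : ∑ j ∈ Finset.insertNone (Finset.insertNone K),
      thetaResidue τ (Finset.insertNone (Finset.insertNone K)) x y j = 0 := by
    refine sum_thetaResidue_eq_zero hτ (pairwise_insertNone (pairwise_insertNone ht hv) ?_) ?_
    · simpa [x, Option.forall, theta_sub_ne_zero_comm (a := v)] using ⟨huv, hu⟩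
    · simp only [Finset.sum_insertNone, x, y, Option.elim_none, Option.elim_some,
        Finset.sum_add_distrib, Finset.sum_const, nsmul_eq_mul]
      linear_combination hsum
  have residue_of_mem (j : κ) (hj : j ∈ K) :
      theta τ (t j - p) / theta τ (t j - u) * (theta τ (t j - r) / theta τ (t j - v)
        * thetaResidue τ K t (fun i => t i + h) j)
      = -(theta τ h * theta τ (t j - p) * theta τ (t j - r)
        / (theta τ (t j - u) * theta τ (t j - v))
        * ∏ i ∈ K.erase j, shiftRatio τ h (t j) (t i)) := by
    simp only [shiftRatio, Finset.prod_div_distrib]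
    rw [thetaResidue, ← Finset.mul_prod_erase K _ hj, sub_add_cancel_left, theta_neg]
    simp only [sub_sub, div_eq_mul_inv, mul_inv]
    ring
  simp only [Finset.sum_insertNone, thetaResidue_insertNone_none, thetaResidue_insertNone_some,
    Finset.prod_insertNone, x, y, Option.elim_none, Option.elim_some] at sum_residues
  rw [Finset.sum_congr rfl residue_of_mem, Finset.sum_neg_distrib, theta_sub_comm τ v u]
    at sum_residues
  simp only [← sub_sub, div_neg] at sum_residues
  simp only [shiftRatio] at sum_residues ⊢
  linear_combination -sum_residues

end PartialFractions

section ExchangeIdentities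

/-- The ratio `θ(a - b - x) θ(g) / θ(a - b)` which, divided by `θ(x)`, is the coefficient with which
the spectral parameters `a` and `b` are interchanged in the dynamical commutation relations. -/
def exchangeRatio (τ g x a b : ℂ) : ℂ := theta τ (a - b - x) * theta τ g / theta τ (a - b)

lemma shiftRatio_neg (τ g a b : ℂ) : shiftRatio τ (-g) a b = shiftRatio τ g b a := by
  rw [shiftRatio_swap τ g b a, shiftRatio, sub_neg_eq_add]

lemma exchangeRatio_neg (τ g x a b : ℂ) :
    exchangeRatio τ (-g) x a b = -exchangeRatio τ g x a b := by
  rw [exchangeRatio, exchangeRatio, theta_neg, mul_neg, neg_div]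

variable {ι : Type*} [DecidableEq ι] {τ t₀ s p q g ν ρ μ : ℂ} {K : Finset ι} {t : ι → ℂ}

lemma raising_identity_of_ne (hτ : 0 < τ.im)
    (ht : (K : Set ι).Pairwise fun i j => theta τ (t i - t j) ≠ 0)
    (ht₀ : ∀ j ∈ K, theta τ (t₀ - t j) ≠ 0) (hs : ∀ j ∈ K, theta τ (s + t j) ≠ 0)
    (hs₀ : theta τ (s + t₀) ≠ 0) (hν : ν = s + p + g * K.card) :
    (∏ i ∈ K, theta τ (s + t i + g)) * (theta τ (t₀ - p - g * K.card) * theta τ (s + p))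
      + ∑ j ∈ K, theta τ (t j - p) * exchangeRatio τ g ν t₀ (t j) * theta τ (s + t₀)
          * ∏ i ∈ K.erase j, shiftRatio τ g (t j) (t i) * theta τ (s + t i)
      = theta τ ν * theta τ (t₀ - p) * ∏ i ∈ K, shiftRatio τ g t₀ (t i) * theta τ (s + t i) := by
  have hS := Finset.prod_ne_zero_iff.mpr hs
  have partial_fractions := partial_fraction_shift hτ (K := K) (t := t) (u := t₀) (v := -s)
    (p := p) (r := t₀ - ν) (h := g) ht (fun j hj => theta_sub_ne_zero_comm.mp (ht₀ j hj))
    (fun j hj => by rw [sub_neg_eq_add, add_comm]; exact hs j hj)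
    (by rw [sub_neg_eq_add, add_comm]; exact hs₀) (by rw [hν]; ring)
  have summand (j : ι) (hj : j ∈ K) :
      theta τ (t j - p) * exchangeRatio τ g ν t₀ (t j) * theta τ (s + t₀)
        * ∏ i ∈ K.erase j, shiftRatio τ g (t j) (t i) * theta τ (s + t i)
      = (theta τ (s + t₀) * ∏ i ∈ K, theta τ (s + t i))
        * (theta τ g * theta τ (t j - p) * theta τ (t j - (t₀ - ν))
          / (theta τ (t j - t₀) * theta τ (t j - -s))
          * ∏ i ∈ K.erase j, shiftRatio τ g (t j) (t i)) := by
    have h₀ := ht₀ j hj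
    have hj' := hs j hj
    rw [exchangeRatio, Finset.prod_mul_distrib, ← Finset.mul_prod_erase K _ hj,
      theta_sub_comm τ (t j) t₀, theta_sub_comm τ (t j) (t₀ - ν), sub_neg_eq_add, add_comm (t j),
      sub_right_comm]
    field_simp
  have prod_at_neg : ∏ i ∈ K, shiftRatio τ g (-s) (t i)
      = (∏ i ∈ K, theta τ (s + t i + g)) / ∏ i ∈ K, theta τ (s + t i) := by
    rw [← Finset.prod_div_distrib]
    refine Finset.prod_congr rfl fun i _ => ?_
    rw [shiftRatio_swap, sub_neg_eq_add, add_comm (t i)]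
  rw [Finset.sum_congr rfl summand, ← Finset.mul_sum, partial_fractions, prod_at_neg,
    Finset.prod_mul_distrib, show t₀ - -s = s + t₀ by ring, show -s - p = -(s + p) by ring,
    theta_neg, show -s - (t₀ - ν) = -(t₀ - p - g * K.card) by rw [hν]; ring, theta_neg,
    sub_sub_cancel]
  field_simp
  ring

lemma raising_identity (hτ : 0 < τ.im)
    (ht : (K : Set ι).Pairwise fun i j => theta τ (t i - t j) ≠ 0)
    (ht₀ : ∀ j ∈ K, theta τ (t₀ - t j) ≠ 0) (hν : ν = s + p + g * K.card) :
    (∏ i ∈ K, theta τ (s + t i + g)) * (theta τ (t₀ - p - g * K.card) * theta τ (s + p))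
      + ∑ j ∈ K, theta τ (t j - p) * exchangeRatio τ g ν t₀ (t j) * theta τ (s + t₀)
          * ∏ i ∈ K.erase j, shiftRatio τ g (t j) (t i) * theta τ (s + t i)
      = theta τ ν * theta τ (t₀ - p) * ∏ i ∈ K, shiftRatio τ g t₀ (t i) * theta τ (s + t i) := by
  subst hν
  have := (differentiable_theta hτ).continuous
  refine eq_of_eventuallyEq_codiscrete (x := s)
    (f := fun s => (∏ i ∈ K, theta τ (s + t i + g))
        * (theta τ (t₀ - p - g * K.card) * theta τ (s + p))
      + ∑ j ∈ K, theta τ (t j - p) * exchangeRatio τ g (s + p + g * K.card) t₀ (t j)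
          * theta τ (s + t₀)
          * ∏ i ∈ K.erase j, shiftRatio τ g (t j) (t i) * theta τ (s + t i))
    (g := fun s => theta τ (s + p + g * K.card) * theta τ (t₀ - p)
      * ∏ i ∈ K, shiftRatio τ g t₀ (t i) * theta τ (s + t i)) ?_ ?_ ?_
  · simp only [exchangeRatio]
    fun_prop
  · fun_prop
  · filter_upwards [K.eventually_all.mpr fun j _ => eventually_theta_add_ne_zero hτ (t j),
      eventually_theta_add_ne_zero hτ t₀] with s hs hs₀
    exact raising_identity_of_ne hτ ht ht₀ hs hs₀ rfl

lemma dual_raising_identity_of_ne (hτ : 0 < τ.im)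
    (ht : (K : Set ι).Pairwise fun i j => theta τ (t i - t j) ≠ 0)
    (ht₀ : ∀ j ∈ K, theta τ (t₀ - t j) ≠ 0) (htg : ∀ j ∈ K, theta τ (t₀ - t j - g) ≠ 0)
    (hμ : μ = s + q - g * (K.card - 1)) :
    ∑ j ∈ K, theta τ (t j - q) * exchangeRatio τ g μ t₀ (t j) * theta τ (s - g + t₀)
        * ∏ i ∈ K.erase j, shiftRatio τ g t₀ (t i) * shiftRatio τ g (t i) (t j) * theta τ (s + t i)
      = theta τ (t₀ - q + g * (K.card - 1)) * theta τ (s + q)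
          * ∏ i ∈ K, shiftRatio τ g t₀ (t i) * theta τ (s - g + t i)
        - theta τ (μ - g) * theta τ (t₀ - g - q) * ∏ i ∈ K, theta τ (s + t i) := by
  have shift_back (i : ι) (hi : i ∈ K) :
      shiftRatio τ (-g) (t₀ - g) (t i) * shiftRatio τ g t₀ (t i) = 1 := by
    rw [shiftRatio, shiftRatio, sub_neg_eq_add, sub_right_comm, sub_add_cancel,
      div_mul_div_cancel₀ (htg i hi), div_self (ht₀ i hi)]
  have summand (j : ι) (hj : j ∈ K) :
      theta τ (t j - q) * exchangeRatio τ g μ t₀ (t j) * theta τ (s - g + t₀)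
        * ∏ i ∈ K.erase j, shiftRatio τ g t₀ (t i) * shiftRatio τ g (t i) (t j) * theta τ (s + t i)
      = -((∏ i ∈ K, shiftRatio τ g t₀ (t i))
        * (theta τ (t j - q) * exchangeRatio τ (-g) (μ - g) (t₀ - g) (t j) * theta τ (s + (t₀ - g))
          * ∏ i ∈ K.erase j, shiftRatio τ (-g) (t j) (t i) * theta τ (s + t i))) := by
    have exchange_back : exchangeRatio τ g μ t₀ (t j)
        = -(exchangeRatio τ (-g) (μ - g) (t₀ - g) (t j) * shiftRatio τ g t₀ (t j)) := by
      rw [exchangeRatio, exchangeRatio, shiftRatio, theta_neg, sub_right_comm t₀ g,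
        sub_sub_sub_cancel_right, div_mul_div_cancel₀ (htg j hj)]
      ring
    simp only [shiftRatio_neg, exchange_back, Finset.prod_mul_distrib]
    rw [← Finset.mul_prod_erase K (fun i => shiftRatio τ g t₀ (t i)) hj,
      show s - g + t₀ = s + (t₀ - g) by ring]
    ring
  have raising := raising_identity (t₀ := t₀ - g) (s := s) (p := q) (g := -g) (ν := μ - g) hτ ht
    (fun j hj => by rw [sub_right_comm]; exact htg j hj) (by rw [hμ]; ring)
  have cancel := Finset.prod_congr rfl shift_back
  rw [Finset.prod_mul_distrib, Finset.prod_const_one] at cancel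
  rw [Finset.sum_congr rfl summand, Finset.sum_neg_distrib, ← Finset.mul_sum]
  have shift_arg (i : ι) : s + t i + -g = s - g + t i := by ring
  simp only [Finset.prod_mul_distrib, shift_arg] at raising ⊢
  rw [show t₀ - g - q - -g * K.card = t₀ - q + g * (K.card - 1) by ring] at raising
  linear_combination -(∏ i ∈ K, shiftRatio τ g t₀ (t i)) * raising
    - theta τ (μ - g) * theta τ (t₀ - g - q) * (∏ i ∈ K, theta τ (s + t i)) * cancel

lemma continuousAt_shiftRatio (hτ : 0 < τ.im) (g : ℂ) {a b : ℂ} (h : theta τ (a - b) ≠ 0) :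
    ContinuousAt (fun a => shiftRatio τ g a b) a := by
  have := (differentiable_theta hτ).continuous
  exact ContinuousAt.div (by fun_prop) (by fun_prop) h

lemma continuousAt_exchangeRatio (hτ : 0 < τ.im) (g x : ℂ) {a b : ℂ} (h : theta τ (a - b) ≠ 0) :
    ContinuousAt (fun a => exchangeRatio τ g x a b) a := by
  have := (differentiable_theta hτ).continuous
  exact ContinuousAt.div (by fun_prop) (by fun_prop) h

lemma dual_raising_identity (hτ : 0 < τ.im)
    (ht : (K : Set ι).Pairwise fun i j => theta τ (t i - t j) ≠ 0)
    (ht₀ : ∀ j ∈ K, theta τ (t₀ - t j) ≠ 0) (hμ : μ = s + q - g * (K.card - 1)) :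
    ∑ j ∈ K, theta τ (t j - q) * exchangeRatio τ g μ t₀ (t j) * theta τ (s - g + t₀)
        * ∏ i ∈ K.erase j, shiftRatio τ g t₀ (t i) * shiftRatio τ g (t i) (t j) * theta τ (s + t i)
      = theta τ (t₀ - q + g * (K.card - 1)) * theta τ (s + q)
          * ∏ i ∈ K, shiftRatio τ g t₀ (t i) * theta τ (s - g + t i)
        - theta τ (μ - g) * theta τ (t₀ - g - q) * ∏ i ∈ K, theta τ (s + t i) := by
  have := (differentiable_theta hτ).continuous
  have continuousAt_prod (S : Finset ι) (hS : S ⊆ K) (c : ι → ℂ) :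
      ContinuousAt (fun t₀ => ∏ i ∈ S, shiftRatio τ g t₀ (t i) * c i) t₀ :=
    tendsto_finsetProd _ fun i hi =>
      (continuousAt_shiftRatio hτ g (ht₀ i (hS hi))).mul continuousAt_const
  refine eq_of_eventuallyEq_codiscrete (x := t₀)
    (f := fun t₀ => ∑ j ∈ K, theta τ (t j - q) * exchangeRatio τ g μ t₀ (t j)
        * theta τ (s - g + t₀)
        * ∏ i ∈ K.erase j, shiftRatio τ g t₀ (t i) * shiftRatio τ g (t i) (t j) * theta τ (s + t i))
    (g := fun t₀ => theta τ (t₀ - q + g * (K.card - 1)) * theta τ (s + q)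
        * ∏ i ∈ K, shiftRatio τ g t₀ (t i) * theta τ (s - g + t i)
      - theta τ (μ - g) * theta τ (t₀ - g - q) * ∏ i ∈ K, theta τ (s + t i)) ?_ ?_ ?_
  · simp only [mul_assoc]
    exact tendsto_finsetSum _ fun j hj => continuousAt_const.mul
      ((continuousAt_exchangeRatio hτ g μ (ht₀ j hj)).mul
        (ContinuousAt.mul (by fun_prop) (continuousAt_prod _ (Finset.erase_subset j K) _)))
  · exact ((Continuous.continuousAt (by fun_prop)).mul (continuousAt_prod _ subset_rfl _)).sub
      (Continuous.continuousAt (by fun_prop))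
  · filter_upwards [K.eventually_all.mpr fun j _ => eventually_theta_sub_ne_zero hτ (t j),
      K.eventually_all.mpr fun j _ => eventually_theta_sub_ne_zero hτ (t j + g)] with t₀ h₀ hg
    exact dual_raising_identity_of_ne hτ ht h₀ (fun j hj => by rw [sub_sub]; exact hg j hj) hμ

lemma exchange_identity_of_ne (hτ : 0 < τ.im)
    (ht : (K : Set ι).Pairwise fun i j => theta τ (t i - t j) ≠ 0)
    (ht₀ : ∀ j ∈ K, theta τ (t₀ - t j) ≠ 0) (hs₀ : theta τ (s - g + t₀) ≠ 0)
    (hρ : ρ = s + p + g * (K.card - 1)) (hμ : μ = s + q - g * (K.card - 1)) :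
    theta τ (t₀ - q + g * (K.card - 1)) * theta τ (s + q)
        * (∑ j ∈ K, theta τ (t j - p) * exchangeRatio τ g ρ t₀ (t j)
          * ∏ i ∈ K.erase j, shiftRatio τ g (t j) (t i) * theta τ (s - g + t i))
        - (∏ i ∈ K, theta τ (s + t i)) * (theta τ (t₀ - p - q - s)
          * theta τ (q - p - g * (K.card - 1)) * theta τ (g * K.card))
      = theta τ ρ * theta τ (t₀ - p)
        * ∑ j ∈ K, theta τ (t j - q) * exchangeRatio τ g μ t₀ (t j)
          * ∏ i ∈ K.erase j,
            shiftRatio τ g t₀ (t i) * shiftRatio τ g (t i) (t j) * theta τ (s + t i) := by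
  have raising := raising_identity (s := s - g) (p := p) (g := g) (ν := ρ) hτ ht ht₀
    (by rw [hρ]; ring)
  have dual := dual_raising_identity (q := q) hτ ht ht₀ hμ
  have three_term := theta_three_term hτ (t₀ - p) (-(g * K.card)) (-(q - p - g * (K.card - 1)))
    (s + q)
  have factor_sum (F G : ι → ℂ) : ∑ j ∈ K, F j * theta τ (s - g + t₀) * G j
      = theta τ (s - g + t₀) * ∑ j ∈ K, F j * G j := by
    rw [Finset.mul_sum]
    exact Finset.sum_congr rfl fun j _ => by ring
  rw [factor_sum] at raising dual
  have shift_arg (i : ι) : s - g + t i + g = s + t i := by ring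
  simp only [shift_arg] at raising
  rw [show t₀ - p + -(g * K.card) = t₀ - p - g * K.card by ring,
    show t₀ - p + -(q - p - g * (K.card - 1)) = t₀ - q + g * (K.card - 1) by ring,
    show s + q + -(g * K.card) + -(q - p - g * (K.card - 1)) = s - g + p by ring,
    show t₀ - p - g * K.card + -(q - p - g * (K.card - 1)) = t₀ - g - q by ring,
    show s + q + -(g * K.card) = μ - g by rw [hμ]; ring,
    show s + q + -(q - p - g * (K.card - 1)) = ρ by rw [hρ]; ring,
    show t₀ - p - (s + q) = t₀ - p - q - s by ring,
    show t₀ - p + (s + q) + -(g * K.card) + -(q - p - g * (K.card - 1)) = s - g + t₀ by ring,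
    theta_neg, theta_neg] at three_term
  refine mul_left_cancel₀ hs₀ ?_
  linear_combination theta τ (t₀ - q + g * (K.card - 1)) * theta τ (s + q) * raising
    - theta τ ρ * theta τ (t₀ - p) * dual - (∏ i ∈ K, theta τ (s + t i)) * three_term

lemma exchange_identity (hτ : 0 < τ.im)
    (ht : (K : Set ι).Pairwise fun i j => theta τ (t i - t j) ≠ 0)
    (ht₀ : ∀ j ∈ K, theta τ (t₀ - t j) ≠ 0) (hρ : ρ = s + p + g * (K.card - 1))
    (hμ : μ = s + q - g * (K.card - 1)) :
    theta τ (t₀ - q + g * (K.card - 1)) * theta τ (s + q)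
        * (∑ j ∈ K, theta τ (t j - p) * exchangeRatio τ g ρ t₀ (t j)
          * ∏ i ∈ K.erase j, shiftRatio τ g (t j) (t i) * theta τ (s - g + t i))
        - (∏ i ∈ K, theta τ (s + t i)) * (theta τ (t₀ - p - q - s)
          * theta τ (q - p - g * (K.card - 1)) * theta τ (g * K.card))
      = theta τ ρ * theta τ (t₀ - p)
        * ∑ j ∈ K, theta τ (t j - q) * exchangeRatio τ g μ t₀ (t j)
          * ∏ i ∈ K.erase j,
            shiftRatio τ g t₀ (t i) * shiftRatio τ g (t i) (t j) * theta τ (s + t i) := by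
  subst hρ hμ
  have := (differentiable_theta hτ).continuous
  refine eq_of_eventuallyEq_codiscrete (x := s)
    (f := fun s => theta τ (t₀ - q + g * (K.card - 1)) * theta τ (s + q)
        * (∑ j ∈ K, theta τ (t j - p) * exchangeRatio τ g (s + p + g * (K.card - 1)) t₀ (t j)
          * ∏ i ∈ K.erase j, shiftRatio τ g (t j) (t i) * theta τ (s - g + t i))
      - (∏ i ∈ K, theta τ (s + t i)) * (theta τ (t₀ - p - q - s)
          * theta τ (q - p - g * (K.card - 1)) * theta τ (g * K.card)))
    (g := fun s => theta τ (s + p + g * (K.card - 1)) * theta τ (t₀ - p)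
      * ∑ j ∈ K, theta τ (t j - q) * exchangeRatio τ g (s + q - g * (K.card - 1)) t₀ (t j)
        * ∏ i ∈ K.erase j,
          shiftRatio τ g t₀ (t i) * shiftRatio τ g (t i) (t j) * theta τ (s + t i)) ?_ ?_ ?_
  · simp only [exchangeRatio]
    fun_prop
  · simp only [exchangeRatio]
    fun_prop
  · filter_upwards [eventually_theta_add_ne_zero hτ (t₀ - g)] with s hs
    exact exchange_identity_of_ne hτ ht ht₀ (by rwa [sub_add_eq_add_sub, add_sub_assoc]) rfl rfl

end ExchangeIdentities

/-! ### Splitting off the last tensor factor -/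

section TensorFactor

variable {n : ℕ}

/-- The linear map `v ↦ e[α] ⊗ v`. -/
def auxTensorMap (α : ℤˣ) : TensorSpace n →ₗ[ℂ] AuxTensorSpace n :=
  Finsupp.lmapDomain ℂ ℂ (Prod.mk α)

/-- The linear map `e[1] ⊗ v_1 + e[-1] ⊗ v_{-1} ↦ v_β`. -/
def auxComponentMap (β : ℤˣ) : AuxTensorSpace n →ₗ[ℂ] TensorSpace n :=
  Finsupp.lcomapDomain (Prod.mk β) (Prod.mk_right_injective β)

/-- The map `v ↦ v ⊗ e_k` from `W` to `W ⊗ V_Λ(z)`. -/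
def snocMap (k : ℕ) : TensorSpace n →ₗ[ℂ] TensorSpace (n + 1) :=
  Finsupp.lmapDomain ℂ ℂ fun κ : Fin n → ℕ => (Fin.snoc κ k : Fin (n + 1) → ℕ)

/-- The map `u ↦ u ⊗ e_k` from `V ⊗ W` to `V ⊗ W ⊗ V_Λ(z)`. -/
def auxSnocMap (k : ℕ) : AuxTensorSpace n →ₗ[ℂ] AuxTensorSpace (n + 1) :=
  Finsupp.lmapDomain ℂ ℂ fun v : ℤˣ × (Fin n → ℕ) => (v.1, (Fin.snoc v.2 k : Fin (n + 1) → ℕ))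

/-- The matrix element `e[α] → e[β]` of the `L`-operator `L(w, x)` of the tensor product. -/
def entryMap (τ η : ℂ) (Λ z : Fin n → ℂ) (β α : ℤˣ) (w x : ℂ) :
    TensorSpace n →ₗ[ℂ] TensorSpace n :=
  auxComponentMap β ∘ₗ tensorL τ η Λ z w x ∘ₗ auxTensorMap α

/-- The value `x - 2η(Λ - 2k)` taken by `x - 2ηh` on the basis vector `e_k` of `V_Λ(z)`, for `k` in
`ℂ` rather than in `ℕ` so that `k - 1` is not truncated. -/
def cartanShift (η Λ x k : ℂ) : ℂ := x - 2 * η * (Λ - 2 * k)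

lemma auxTensorMap_single (α : ℤˣ) (κ : Fin n → ℕ) (a : ℂ) :
    auxTensorMap α (Finsupp.single κ a) = Finsupp.single (α, κ) a :=
  Finsupp.mapDomain_single

lemma snocMap_single (k : ℕ) (κ : Fin n → ℕ) (a : ℂ) :
    snocMap k (Finsupp.single κ a) = Finsupp.single (Fin.snoc κ k : Fin (n + 1) → ℕ) a :=
  Finsupp.mapDomain_single

lemma auxSnocMap_single (k : ℕ) (v : ℤˣ × (Fin n → ℕ)) (a : ℂ) :
    auxSnocMap k (Finsupp.single v a)
      = Finsupp.single (v.1, (Fin.snoc v.2 k : Fin (n + 1) → ℕ)) a :=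
  Finsupp.mapDomain_single

lemma auxComponentMap_single (β γ : ℤˣ) (κ : Fin n → ℕ) (a : ℂ) :
    auxComponentMap β (Finsupp.single (γ, κ) a) = if γ = β then Finsupp.single κ a else 0 := by
  ext κ'
  change Finsupp.single (γ, κ) a (β, κ') = _
  split_ifs with h
  · subst h
    simp [Finsupp.single_apply]
  · simp [h]

lemma auxTensorMap_snocMap (α : ℤˣ) (k : ℕ) (v : TensorSpace n) :
    auxTensorMap α (snocMap k v) = auxSnocMap k (auxTensorMap α v) := by
  simp only [auxTensorMap, snocMap, auxSnocMap, Finsupp.lmapDomain_apply,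
    ← Finsupp.mapDomain_comp, Function.comp_def]

lemma auxComponentMap_auxSnocMap (β : ℤˣ) (k : ℕ) (u : AuxTensorSpace n) :
    auxComponentMap β (auxSnocMap k u) = snocMap k (auxComponentMap β u) := by
  induction u using Finsupp.induction_linear with
  | zero => simp only [map_zero]
  | add f g hf hg => simp only [map_add, hf, hg]
  | single v a =>
    obtain ⟨γ, κ⟩ := v
    rw [auxSnocMap_single, auxComponentMap_single, auxComponentMap_single]
    split_ifs
    · rw [snocMap_single]
    · rw [map_zero]

lemma sum_Ioi_castSucc {M : Type*} [AddCommMonoid M] (i : Fin n) (f : Fin (n + 1) → M) :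
    ∑ l ∈ Finset.Ioi i.castSucc, f l = ∑ l ∈ Finset.Ioi i, f l.castSucc + f (Fin.last n) := by
  simp only [← Finset.filter_lt_eq_Ioi, Finset.sum_filter, Fin.sum_univ_castSucc,
    Fin.castSucc_lt_castSucc_iff, Fin.castSucc_lt_last, if_true]

lemma Ioi_last_eq_empty : Finset.Ioi (Fin.last n) = ∅ :=
  Finset.Ioi_eq_empty.2 isMax_top

lemma siteL_single (τ η : ℂ) (Λ z : Fin n → ℂ) (w x : ℂ) (k : Fin n) (v : ℤˣ × (Fin n → ℕ))
    (a : ℂ) :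
    siteL τ η Λ z w x k (Finsupp.single v a)
      = a • Finsupp.mapDomain (fun u : ℤˣ × ℕ => (u.1, Function.update v.2 k u.2))
        (vermaLBasis τ η (Λ k) (z k) w
          (x - 2 * η * ∑ l ∈ Finset.Ioi k, (Λ l - 2 * (v.2 l : ℂ))) v.1 (v.2 k)) := by
  rw [siteL, Finsupp.linearCombination_single]

lemma vermaC_zero (τ η Λ z w x : ℂ) : vermaC τ η Λ z w x 0 = 0 := by
  simp [vermaC, theta_zero]

lemma entryOp_apply (τ η : ℂ) (Λ z : Fin n → ℂ) (β α : ℤˣ) (w : ℂ) (f : ℂ → TensorSpace n)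
    (x : ℂ) :
    entryOp τ η Λ z β α w f x = entryMap τ η Λ z β α w x (f (x - 2 * η * ((α : ℤ) : ℂ))) :=
  rfl

variable (τ η : ℂ) (Λ z : Fin (n + 1) → ℂ) (w x : ℂ)

lemma siteL_castSucc_auxSnocMap (k : ℕ) (i : Fin n) (u : AuxTensorSpace n) :
    siteL τ η Λ z w x i.castSucc (auxSnocMap k u)
      = auxSnocMap k (siteL τ η (Fin.init Λ) (Fin.init z) w
          (cartanShift η (Λ (Fin.last n)) x k) i u) := by
  induction u using Finsupp.induction_linear with
  | zero => simp only [map_zero]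
  | add f g hf hg => simp only [map_add, hf, hg]
  | single v a =>
    have hshift : x - 2 * η * ∑ l ∈ Finset.Ioi i.castSucc,
          (Λ l - 2 * ((Fin.snoc v.2 k : Fin (n + 1) → ℕ) l : ℂ))
        = cartanShift η (Λ (Fin.last n)) x k
          - 2 * η * ∑ l ∈ Finset.Ioi i, (Fin.init Λ l - 2 * (v.2 l : ℂ)) := by
      simp only [sum_Ioi_castSucc, Fin.snoc_castSucc, Fin.snoc_last, cartanShift, Fin.init]
      ring
    rw [auxSnocMap_single, siteL_single, siteL_single, map_smul, auxSnocMap,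
      Finsupp.lmapDomain_apply, ← Finsupp.mapDomain_comp, hshift]
    simp only [Function.comp_def, Fin.snoc_castSucc, Fin.snoc_update, Fin.init]

lemma siteL_last_single (k : ℕ) (α : ℤˣ) (κ : Fin n → ℕ) (a : ℂ) :
    siteL τ η Λ z w x (Fin.last n) (Finsupp.single (α, (Fin.snoc κ k : Fin (n + 1) → ℕ)) a)
      = a • Finsupp.mapDomain (fun u : ℤˣ × ℕ => (u.1, (Fin.snoc κ u.2 : Fin (n + 1) → ℕ)))
        (vermaLBasis τ η (Λ (Fin.last n)) (z (Fin.last n)) w x α k) := by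
  simp only [siteL_single, Ioi_last_eq_empty, Finset.sum_empty, mul_zero, sub_zero, Fin.snoc_last,
    Fin.update_snoc_last]

lemma siteL_last_neg_one (k : ℕ) (v : TensorSpace n) :
    siteL τ η Λ z w x (Fin.last n) (auxSnocMap k (auxTensorMap (-1) v))
      = vermaB τ η (Λ (Fin.last n)) (z (Fin.last n)) w x k
          • auxSnocMap (k + 1) (auxTensorMap 1 v)
        + vermaD τ η (Λ (Fin.last n)) (z (Fin.last n)) w x k
          • auxSnocMap k (auxTensorMap (-1) v) := by
  induction v using Finsupp.induction_linear with
  | zero => simp only [map_zero, smul_zero, add_zero]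
  | add f g hf hg => simp only [map_add, hf, hg, smul_add]; abel
  | single κ a =>
    simp only [auxTensorMap_single, auxSnocMap_single, siteL_last_single, vermaLBasis,
      if_neg (show (-1 : ℤˣ) ≠ 1 by decide), Finsupp.mapDomain_add, Finsupp.mapDomain_single,
      smul_add, Finsupp.smul_single, smul_eq_mul, mul_comm a]

lemma siteL_last_one (k : ℕ) (v : TensorSpace n) :
    siteL τ η Λ z w x (Fin.last n) (auxSnocMap k (auxTensorMap 1 v))
      = vermaA τ η (Λ (Fin.last n)) (z (Fin.last n)) w x k
          • auxSnocMap k (auxTensorMap 1 v)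
        + vermaC τ η (Λ (Fin.last n)) (z (Fin.last n)) w x k
          • auxSnocMap (k - 1) (auxTensorMap (-1) v) := by
  induction v using Finsupp.induction_linear with
  | zero => simp only [map_zero, smul_zero, add_zero]
  | add f g hf hg => simp only [map_add, hf, hg, smul_add]; abel
  | single κ a =>
    simp only [auxTensorMap_single, auxSnocMap_single, siteL_last_single, vermaLBasis, if_true,
      Finsupp.mapDomain_add, Finsupp.mapDomain_single, smul_add, Finsupp.smul_single, smul_eq_mul,
      mul_comm a]
    rcases eq_or_ne k 0 with rfl | hk
    · simp only [if_true, vermaC_zero, Finsupp.mapDomain_zero, smul_zero, zero_mul,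
        Finsupp.single_zero]
    · simp only [if_neg hk, Finsupp.mapDomain_single, Finsupp.smul_single, smul_eq_mul, mul_comm a]

lemma prod_siteL_castSucc_auxSnocMap (k : ℕ) (l : List (Fin n)) (u : AuxTensorSpace n) :
    (l.map fun i => siteL τ η Λ z w x i.castSucc).prod (auxSnocMap k u)
      = auxSnocMap k ((l.map (siteL τ η (Fin.init Λ) (Fin.init z) w
          (cartanShift η (Λ (Fin.last n)) x k))).prod u) := by
  induction l with
  | nil => rfl
  | cons i l ih =>
    rw [List.map_cons, List.prod_cons, List.map_cons, List.prod_cons, Module.End.mul_apply,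
      Module.End.mul_apply, ih, siteL_castSucc_auxSnocMap]

lemma tensorL_succ (u : AuxTensorSpace (n + 1)) :
    tensorL τ η Λ z w x u = ((List.finRange n).map fun i => siteL τ η Λ z w x i.castSucc).prod
      (siteL τ η Λ z w x (Fin.last n) u) := by
  rw [tensorL, List.finRange_succ_last, List.map_append, List.prod_append, List.map_map,
    Module.End.mul_apply, List.map_singleton, List.prod_singleton]
  rfl

lemma entryMap_b_snocMap (k : ℕ) (v : TensorSpace n) :
    entryMap τ η Λ z 1 (-1) w x (snocMap k v)
      = vermaB τ η (Λ (Fin.last n)) (z (Fin.last n)) w x k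
          • snocMap (k + 1) (entryMap τ η (Fin.init Λ) (Fin.init z) 1 1 w
            (cartanShift η (Λ (Fin.last n)) x (k + 1)) v)
        + vermaD τ η (Λ (Fin.last n)) (z (Fin.last n)) w x k
          • snocMap k (entryMap τ η (Fin.init Λ) (Fin.init z) 1 (-1) w
            (cartanShift η (Λ (Fin.last n)) x k) v) := by
  simp only [entryMap, LinearMap.comp_apply, auxTensorMap_snocMap, tensorL_succ,
    siteL_last_neg_one, map_add, map_smul, prod_siteL_castSucc_auxSnocMap,
    auxComponentMap_auxSnocMap, Nat.cast_succ]
  rfl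

lemma entryMap_a_snocMap (k : ℕ) (v : TensorSpace n) :
    entryMap τ η Λ z 1 1 w x (snocMap k v)
      = vermaA τ η (Λ (Fin.last n)) (z (Fin.last n)) w x k
          • snocMap k (entryMap τ η (Fin.init Λ) (Fin.init z) 1 1 w
            (cartanShift η (Λ (Fin.last n)) x k) v)
        + vermaC τ η (Λ (Fin.last n)) (z (Fin.last n)) w x k
          • snocMap (k - 1) (entryMap τ η (Fin.init Λ) (Fin.init z) 1 (-1) w
            (cartanShift η (Λ (Fin.last n)) x (k - 1)) v) := by
  simp only [entryMap, LinearMap.comp_apply, auxTensorMap_snocMap, tensorL_succ,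
    siteL_last_one, map_add, map_smul, prod_siteL_castSucc_auxSnocMap, auxComponentMap_auxSnocMap]
  rcases eq_or_ne k 0 with rfl | hk
  · simp only [vermaC_zero, zero_smul]
    rfl
  · rw [Nat.cast_pred (Nat.pos_of_ne_zero hk)]
    rfl

end TensorFactor

/-! ### Splittings of the variables and their weights -/

section SplitWeight

variable {ι : Type*} (τ η Λ z : ℂ) (t : ι → ℂ)

lemma qPar_eq_pPar_add : qPar η Λ z = pPar η Λ z + 2 * η * Λ := by
  rw [qPar, pPar]
  ring

lemma vermaA_eq (w x : ℂ) (k : ℕ) :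
    vermaA τ η Λ z w x k = theta τ (w - qPar η Λ z + 2 * η * k) * theta τ (x + 2 * η * k)
      / (theta τ (w - qPar η Λ z) * theta τ x) := by
  rw [vermaA, qPar, show z - w + (Λ + 1 - 2 * k) * η = -(w - (z + η * (Λ + 1)) + 2 * η * k) by ring,
    show z - w + (Λ + 1) * η = -(w - (z + η * (Λ + 1))) by ring, theta_neg, theta_neg,
    neg_div_neg_eq, div_mul_div_comm, mul_right_comm 2]

lemma vermaB_eq (w x : ℂ) (k : ℕ) :
    vermaB τ η Λ z w x k = -(theta τ (2 * η) / theta τ x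
      * (theta τ (x - qPar η Λ z + 2 * η * (k + 1) + w) / theta τ (w - qPar η Λ z))) := by
  rw [vermaB, qPar, show -x + z - w + (Λ - 1 - 2 * k) * η
      = -(x - (z + η * (Λ + 1)) + 2 * η * (k + 1) + w) by ring,
    show z - w + (Λ + 1) * η = -(w - (z + η * (Λ + 1))) by ring, theta_neg, theta_neg,
    neg_div_neg_eq, mul_comm (_ / _)]

lemma vermaC_eq (w x : ℂ) (k : ℕ) :
    vermaC τ η Λ z w x k = theta τ (w - pPar η Λ z - x - 2 * η * (k - 1))
      * theta τ (2 * η * (Λ + 1 - k)) * theta τ (2 * η * k)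
      / (theta τ (w - qPar η Λ z) * theta τ x * theta τ (2 * η)) := by
  rw [vermaC, pPar, qPar, show -x - z + w + (Λ + 1 - 2 * k) * η
      = w - (z + η * (-Λ + 1)) - x - 2 * η * (k - 1) by ring,
    show z - w + (Λ + 1) * η = -(w - (z + η * (Λ + 1))) by ring, theta_neg,
    mul_right_comm 2 (Λ + 1 - (k : ℂ)), mul_right_comm 2 (k : ℂ), div_neg, neg_mul, neg_mul,
    neg_neg, div_mul_div_comm, div_mul_div_comm]

lemma vermaD_eq (w x : ℂ) (k : ℕ) :
    vermaD τ η Λ z w x k = theta τ (w - pPar η Λ z - 2 * η * k) * theta τ (x - 2 * η * (Λ - k))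
      / (theta τ (w - qPar η Λ z) * theta τ x) := by
  rw [vermaD, pPar, qPar, show z - w + (-Λ + 1 + 2 * k) * η
      = -(w - (z + η * (-Λ + 1)) - 2 * η * k) by ring,
    show z - w + (Λ + 1) * η = -(w - (z + η * (Λ + 1))) by ring, theta_neg, theta_neg,
    neg_div_neg_eq, div_mul_div_comm, mul_right_comm 2 (Λ - (k : ℂ))]

/-- The factor of `splitWeight` which does not depend on the dynamical parameter. -/
def splitFactor (J K : Finset ι) : ℂ :=
  (∏ i ∈ J, theta τ (t i - pPar η Λ z) / theta τ (t i - qPar η Λ z))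
    * (∏ j ∈ K, (theta τ (t j - qPar η Λ z))⁻¹)
    * ∏ i ∈ J, ∏ j ∈ K, shiftRatio τ (2 * η) (t i) (t j)

/-- The weight with which a splitting `J ⊔ K` of the variables enters the Bethe vector of
`W ⊗ V_Λ(z)`: the variables in `J` are attached to `W` and those in `K` to `V_Λ(z)`. -/
def splitWeight (J K : Finset ι) (x : ℂ) : ℂ :=
  splitFactor τ η Λ z t J K * ∏ j ∈ K, theta τ (x - qPar η Λ z + 2 * η * K.card + t j)

variable {τ η Λ z t}

lemma splitWeight_eq {x s : ℂ} {J K : Finset ι} (h : x - qPar η Λ z + 2 * η * K.card = s) :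
    splitWeight τ η Λ z t J K x = splitFactor τ η Λ z t J K * ∏ j ∈ K, theta τ (s + t j) := by
  rw [splitWeight, h]

variable [DecidableEq ι]

variable (τ η t) in
/-- The coefficient, in `a(t_{i₀})` applied to the Bethe vector with variables `T`, of the Bethe
vector in which `t_{i₀}` replaces `t_j`. -/
def exchangeCoeff (i₀ : ι) (T : Finset ι) (j : ι) (x : ℂ) : ℂ :=
  exchangeRatio τ (2 * η) x (t i₀) (t j) / theta τ x
    * ∏ i ∈ T.erase j, shiftRatio τ (2 * η) (t i) (t j)

variable {J K : Finset ι} {i₀ j : ι}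

lemma splitFactor_insert_left (h : i₀ ∉ J) :
    splitFactor τ η Λ z t (insert i₀ J) K
      = theta τ (t i₀ - pPar η Λ z) / theta τ (t i₀ - qPar η Λ z)
        * (∏ i ∈ K, shiftRatio τ (2 * η) (t i₀) (t i)) * splitFactor τ η Λ z t J K := by
  simp only [splitFactor, Finset.prod_insert h]
  ring

lemma splitFactor_insert_right (h : i₀ ∉ K) :
    splitFactor τ η Λ z t J (insert i₀ K)
      = (theta τ (t i₀ - qPar η Λ z))⁻¹
        * (∏ i ∈ J, shiftRatio τ (2 * η) (t i) (t i₀)) * splitFactor τ η Λ z t J K := by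
  simp only [splitFactor, Finset.prod_insert h, Finset.prod_mul_distrib]
  ring

lemma splitFactor_erase_right (hj : j ∈ K) :
    splitFactor τ η Λ z t J K = (theta τ (t j - qPar η Λ z))⁻¹
        * (∏ i ∈ J, shiftRatio τ (2 * η) (t i) (t j)) * splitFactor τ η Λ z t J (K.erase j) := by
  rw [← splitFactor_insert_right (Finset.notMem_erase j K), Finset.insert_erase hj]

lemma prod_mul_splitFactor_erase_right (hj : j ∈ K) (hq : theta τ (t j - qPar η Λ z) ≠ 0) :
    (∏ i ∈ J, shiftRatio τ (2 * η) (t i) (t j)) * splitFactor τ η Λ z t J (K.erase j)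
      = theta τ (t j - qPar η Λ z) * splitFactor τ η Λ z t J K := by
  rw [splitFactor_erase_right hj, mul_assoc, mul_inv_cancel_left₀ hq]

lemma cast_card_erase (h : j ∈ K) : ((K.erase j).card : ℂ) = K.card - 1 := by
  rw [Finset.card_erase_of_mem h, Nat.cast_pred (Finset.card_pos.mpr ⟨j, h⟩)]

lemma erase_union_of_disjoint (hJK : Disjoint J K) (hj : j ∈ K) :
    (J ∪ K).erase j = J ∪ K.erase j := by
  rw [Finset.erase_union_distrib,
    Finset.erase_eq_of_notMem (Finset.disjoint_right.mp hJK hj)]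

lemma prod_erase_union_of_disjoint (hJK : Disjoint J K) (hj : j ∈ K) (f : ι → ℂ) :
    ∏ i ∈ (J ∪ K).erase j, f i = (∏ i ∈ J, f i) * ∏ i ∈ K.erase j, f i := by
  rw [erase_union_of_disjoint hJK hj,
    Finset.prod_union (hJK.mono_right (Finset.erase_subset j K))]

lemma splitWeight_insert_mul_exchangeCoeff (hJK : Disjoint J K) (hj : j ∈ K) {x s ν : ℂ}
    (hs : s = x - qPar η Λ z + 2 * η * (K.card - 1)) :
    splitWeight τ η Λ z t (insert j J) (K.erase j) x * exchangeCoeff τ η t i₀ (insert j J) j ν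
      = splitFactor τ η Λ z t J K / theta τ ν
        * (theta τ (t j - pPar η Λ z) * exchangeRatio τ (2 * η) ν (t i₀) (t j)
          * ∏ i ∈ K.erase j, shiftRatio τ (2 * η) (t j) (t i) * theta τ (s + t i)) := by
  have hjJ : j ∉ J := Finset.disjoint_right.mp hJK hj
  rw [splitWeight_eq (s := s) (by rw [cast_card_erase hj, hs]), exchangeCoeff,
    splitFactor_insert_left hjJ, Finset.erase_insert hjJ, splitFactor_erase_right hj,
    Finset.prod_mul_distrib]
  ring

lemma splitWeight_raise_right (hK : i₀ ∉ K) (x : ℂ) :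
    splitWeight τ η Λ z t J K (x + 2 * η) * vermaB τ η Λ z (t i₀) x K.card
        * ∏ i ∈ J, shiftRatio τ (2 * η) (t i) (t i₀)
      = -(theta τ (2 * η) / theta τ x) * splitWeight τ η Λ z t J (insert i₀ K) x := by
  rw [splitWeight_eq (s := x - qPar η Λ z + 2 * η * (K.card + 1)) (by ring),
    splitWeight_eq (s := x - qPar η Λ z + 2 * η * (K.card + 1))
      (by rw [Finset.card_insert_of_notMem hK, Nat.cast_succ]),
    splitFactor_insert_right hK, vermaB_eq, Finset.prod_insert hK]
  ring

lemma splitWeight_raise_left (hτ : 0 < τ.im) (hJ : i₀ ∉ J) (hJK : Disjoint J K)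
    (ht : (K : Set ι).Pairwise fun i j => theta τ (t i - t j) ≠ 0)
    (ht₀ : ∀ j ∈ K, theta τ (t i₀ - t j) ≠ 0) {x : ℂ}
    (hν : theta τ (cartanShift η Λ x K.card) ≠ 0) :
    (∑ j ∈ K, splitWeight τ η Λ z t (insert j J) (K.erase j) (x + 2 * η)
        * vermaB τ η Λ z (t i₀) x (K.erase j).card
        * exchangeCoeff τ η t i₀ (insert j J) j (cartanShift η Λ x K.card))
      - splitWeight τ η Λ z t J K (x + 2 * η) * vermaD τ η Λ z (t i₀) x K.card
        * (theta τ (2 * η) / theta τ (cartanShift η Λ x K.card))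
      = -(theta τ (2 * η) / theta τ x) * splitWeight τ η Λ z t (insert i₀ J) K x := by
  set ν := cartanShift η Λ x K.card with hνdef
  set s := x - qPar η Λ z + 2 * η * K.card with hs
  have hν' : ν = s + pPar η Λ z + 2 * η * K.card := by
    rw [hνdef, hs, cartanShift, qPar_eq_pPar_add]
    ring
  have raising := raising_identity hτ ht ht₀ hν'
  set c := theta τ (2 * η) / theta τ x
    * (splitFactor τ η Λ z t J K / (theta τ (t i₀ - qPar η Λ z) * theta τ ν)) with hc
  have summand : ∀ j ∈ K, splitWeight τ η Λ z t (insert j J) (K.erase j) (x + 2 * η)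
        * vermaB τ η Λ z (t i₀) x (K.erase j).card * exchangeCoeff τ η t i₀ (insert j J) j ν
      = -c * (theta τ (t j - pPar η Λ z) * exchangeRatio τ (2 * η) ν (t i₀) (t j)
        * theta τ (s + t i₀) * ∏ i ∈ K.erase j, shiftRatio τ (2 * η) (t j) (t i)
          * theta τ (s + t i)) := fun j hj => by
    rw [mul_right_comm, splitWeight_insert_mul_exchangeCoeff hJK hj (s := s) (by rw [hs]; ring),
      vermaB_eq, cast_card_erase hj, sub_add_cancel, ← hs, hc]
    ring
  have harg : x - 2 * η * (Λ - K.card) = s + pPar η Λ z := by rw [hs, qPar_eq_pPar_add]; ring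
  rw [Finset.sum_congr rfl summand, ← Finset.mul_sum, splitWeight_eq (s := s + 2 * η) (by ring),
    splitWeight_eq hs.symm, splitFactor_insert_left hJ, vermaD_eq, harg]
  have cancel : theta τ ν * (theta τ ν)⁻¹ = 1 := mul_inv_cancel₀ hν
  simp only [add_right_comm s (2 * η), Finset.prod_mul_distrib] at raising ⊢
  linear_combination -c * raising - theta τ (2 * η) / theta τ x
    * (theta τ (t i₀ - pPar η Λ z) / theta τ (t i₀ - qPar η Λ z)
      * (∏ i ∈ K, shiftRatio τ (2 * η) (t i₀) (t i)) * splitFactor τ η Λ z t J K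
      * ∏ i ∈ K, theta τ (s + t i)) * cancel

lemma exchangeCoeff_mul_splitWeight_insert_right (hJK : Disjoint J K) (hK : i₀ ∉ K) (hj : j ∈ K)
    (hq : theta τ (t j - qPar η Λ z) ≠ 0) {x s : ℂ} (hs : s = x - qPar η Λ z + 2 * η * K.card) :
    exchangeCoeff τ η t i₀ (J ∪ K) j x * splitWeight τ η Λ z t J (insert i₀ (K.erase j)) x
      = splitFactor τ η Λ z t J K * (∏ i ∈ J, shiftRatio τ (2 * η) (t i) (t i₀))
          / (theta τ (t i₀ - qPar η Λ z) * theta τ x)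
        * (theta τ (t j - qPar η Λ z) * exchangeRatio τ (2 * η) x (t i₀) (t j) * theta τ (s + t i₀)
          * ∏ i ∈ K.erase j, shiftRatio τ (2 * η) (t i) (t j) * theta τ (s + t i)) := by
  have hi₀ : i₀ ∉ K.erase j := fun h => hK (Finset.mem_of_mem_erase h)
  have hcard : ((insert i₀ (K.erase j)).card : ℂ) = K.card := by
    rw [Finset.card_insert_of_notMem hi₀, Finset.card_erase_add_one hj]
  rw [splitWeight_eq (s := s) (by rw [hcard, hs]), exchangeCoeff,
    prod_erase_union_of_disjoint hJK hj, splitFactor_insert_right hi₀, Finset.prod_insert hi₀,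
    Finset.prod_mul_distrib]
  linear_combination (exchangeRatio τ (2 * η) x (t i₀) (t j) / theta τ x
    * (∏ i ∈ K.erase j, shiftRatio τ (2 * η) (t i) (t j)) * (theta τ (t i₀ - qPar η Λ z))⁻¹
    * (∏ i ∈ J, shiftRatio τ (2 * η) (t i) (t i₀)) * theta τ (s + t i₀)
    * ∏ i ∈ K.erase j, theta τ (s + t i)) * prod_mul_splitFactor_erase_right (J := J) hj hq

lemma exchangeCoeff_mul_splitWeight_insert_left (hJK : Disjoint J K) (hJ : i₀ ∉ J) (hj : j ∈ K)
    (hq : theta τ (t j - qPar η Λ z) ≠ 0) {x s : ℂ}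
    (hs : s = x - qPar η Λ z + 2 * η * (K.card - 1)) :
    exchangeCoeff τ η t i₀ (J ∪ K) j x * splitWeight τ η Λ z t (insert i₀ J) (K.erase j) x
      = splitFactor τ η Λ z t J K * theta τ (t i₀ - pPar η Λ z)
          / (theta τ (t i₀ - qPar η Λ z) * theta τ x)
        * (theta τ (t j - qPar η Λ z) * exchangeRatio τ (2 * η) x (t i₀) (t j)
          * ∏ i ∈ K.erase j, shiftRatio τ (2 * η) (t i₀) (t i)
            * shiftRatio τ (2 * η) (t i) (t j) * theta τ (s + t i)) := by
  rw [splitWeight_eq (s := s) (by rw [cast_card_erase hj, hs]), exchangeCoeff,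
    prod_erase_union_of_disjoint hJK hj, splitFactor_insert_left hJ, Finset.prod_mul_distrib,
    Finset.prod_mul_distrib]
  linear_combination (exchangeRatio τ (2 * η) x (t i₀) (t j) / theta τ x
    * (∏ i ∈ K.erase j, shiftRatio τ (2 * η) (t i) (t j)) * theta τ (t i₀ - pPar η Λ z)
    / theta τ (t i₀ - qPar η Λ z) * (∏ i ∈ K.erase j, shiftRatio τ (2 * η) (t i₀) (t i))
    * ∏ i ∈ K.erase j, theta τ (s + t i)) * prod_mul_splitFactor_erase_right (J := J) hj hq

lemma splitWeight_diagonal (hτ : 0 < τ.im) (hK : i₀ ∉ K) (hJK : Disjoint J K)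
    (ht : (K : Set ι).Pairwise fun i j => theta τ (t i - t j) ≠ 0)
    (ht₀ : ∀ j ∈ K, theta τ (t i₀ - t j) ≠ 0) (hq₀ : theta τ (t i₀ - qPar η Λ z) ≠ 0)
    (hq : ∀ j ∈ K, theta τ (t j - qPar η Λ z) ≠ 0) {x : ℂ} (hx : theta τ x ≠ 0) :
    splitWeight τ η Λ z t J K (x - 2 * η) * vermaA τ η Λ z (t i₀) x K.card
        * ∏ i ∈ J, shiftRatio τ (2 * η) (t i) (t i₀)
      = (∏ i ∈ J ∪ K, shiftRatio τ (2 * η) (t i) (t i₀)) * splitWeight τ η Λ z t J K x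
        + ∑ j ∈ K, exchangeCoeff τ η t i₀ (J ∪ K) j x
          * splitWeight τ η Λ z t J (insert i₀ (K.erase j)) x := by
  set s := x - qPar η Λ z + 2 * η * K.card with hs
  have raising := raising_identity (s := s) (p := qPar η Λ z) (g := -(2 * η)) (ν := x) hτ ht ht₀
    (by rw [hs]; ring)
  simp only [shiftRatio_neg, exchangeRatio_neg, mul_neg, neg_mul, sub_neg_eq_add,
    Finset.sum_neg_distrib, ← sub_eq_add_neg, add_sub_right_comm s] at raising
  rw [Finset.sum_congr rfl fun j hj =>
      exchangeCoeff_mul_splitWeight_insert_right hJK hK hj (hq j hj) hs, ← Finset.mul_sum,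
    splitWeight_eq (s := s - 2 * η) (by rw [hs]; ring), splitWeight_eq hs.symm,
    Finset.prod_union hJK, vermaA_eq, show x + 2 * η * K.card = s + qPar η Λ z by rw [hs]; ring]
  have cancel : theta τ x * theta τ (t i₀ - qPar η Λ z)
      * (theta τ x * theta τ (t i₀ - qPar η Λ z))⁻¹ = 1 := mul_inv_cancel₀ (mul_ne_zero hx hq₀)
  simp only [Finset.prod_mul_distrib] at raising ⊢
  linear_combination splitFactor τ η Λ z t J K * (∏ i ∈ J, shiftRatio τ (2 * η) (t i) (t i₀))
      / (theta τ (t i₀ - qPar η Λ z) * theta τ x) * raising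
    + (∏ i ∈ J, shiftRatio τ (2 * η) (t i) (t i₀))
      * (∏ i ∈ K, shiftRatio τ (2 * η) (t i) (t i₀)) * splitFactor τ η Λ z t J K
      * (∏ i ∈ K, theta τ (s + t i)) * cancel

lemma splitWeight_exchange (hτ : 0 < τ.im) (hη : theta τ (2 * η) ≠ 0) (hJ : i₀ ∉ J)
    (hJK : Disjoint J K) (ht : (K : Set ι).Pairwise fun i j => theta τ (t i - t j) ≠ 0)
    (ht₀ : ∀ j ∈ K, theta τ (t i₀ - t j) ≠ 0) (hq : ∀ j ∈ K, theta τ (t j - qPar η Λ z) ≠ 0)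
    {x : ℂ} (hρ : theta τ (cartanShift η Λ x (K.card - 1)) ≠ 0) :
    (∑ j ∈ K, splitWeight τ η Λ z t (insert j J) (K.erase j) (x - 2 * η)
        * vermaA τ η Λ z (t i₀) x (K.erase j).card
        * exchangeCoeff τ η t i₀ (insert j J) j (cartanShift η Λ x (K.card - 1)))
      - splitWeight τ η Λ z t J K (x - 2 * η) * vermaC τ η Λ z (t i₀) x K.card
        * (theta τ (2 * η) / theta τ (cartanShift η Λ x (K.card - 1)))
      = ∑ j ∈ K, exchangeCoeff τ η t i₀ (J ∪ K) j x
          * splitWeight τ η Λ z t (insert i₀ J) (K.erase j) x := by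
  set ρ := cartanShift η Λ x (K.card - 1) with hρdef
  set s := x - qPar η Λ z + 2 * η * (K.card - 1) with hs
  have hρ' : ρ = s + pPar η Λ z + 2 * η * (K.card - 1) := by
    rw [hρdef, hs, cartanShift, qPar_eq_pPar_add]
    ring
  have exchange := exchange_identity (μ := x) (q := qPar η Λ z) hτ ht ht₀ hρ' (by rw [hs]; ring)
  set c := splitFactor τ η Λ z t J K / (theta τ (t i₀ - qPar η Λ z) * theta τ x) with hc
  have summand : ∀ j ∈ K, splitWeight τ η Λ z t (insert j J) (K.erase j) (x - 2 * η)
        * vermaA τ η Λ z (t i₀) x (K.erase j).card * exchangeCoeff τ η t i₀ (insert j J) j ρ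
      = c / theta τ ρ
        * (theta τ (t i₀ - qPar η Λ z + 2 * η * (K.card - 1)) * theta τ (s + qPar η Λ z))
        * (theta τ (t j - pPar η Λ z) * exchangeRatio τ (2 * η) ρ (t i₀) (t j)
          * ∏ i ∈ K.erase j, shiftRatio τ (2 * η) (t j) (t i)
            * theta τ (s - 2 * η + t i)) := fun j hj => by
    rw [mul_right_comm, splitWeight_insert_mul_exchangeCoeff hJK hj (s := s - 2 * η)
      (by rw [hs]; ring), vermaA_eq, cast_card_erase hj, hc,
      show x + 2 * η * (K.card - 1) = s + qPar η Λ z by rw [hs]; ring]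
    ring
  rw [Finset.sum_congr rfl summand, ← Finset.mul_sum,
    Finset.sum_congr rfl fun j hj =>
      exchangeCoeff_mul_splitWeight_insert_left hJK hJ hj (hq j hj) hs, ← Finset.mul_sum,
    splitWeight_eq (s := s) (by rw [hs]; ring), vermaC_eq,
    show t i₀ - pPar η Λ z - x - 2 * η * (K.card - 1) = t i₀ - pPar η Λ z - qPar η Λ z - s by
      rw [hs]; ring,
    show 2 * η * (Λ + 1 - K.card) = qPar η Λ z - pPar η Λ z - 2 * η * (K.card - 1) by
      rw [qPar_eq_pPar_add]; ring]
  have cancel_ρ : theta τ ρ * (theta τ ρ)⁻¹ = 1 := mul_inv_cancel₀ hρ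
  have cancel_η : theta τ (2 * η) * (theta τ (2 * η))⁻¹ = 1 := mul_inv_cancel₀ hη
  linear_combination c / theta τ ρ * exchange
    + c * theta τ (t i₀ - pPar η Λ z) * (∑ j ∈ K, theta τ (t j - qPar η Λ z)
      * exchangeRatio τ (2 * η) x (t i₀) (t j) * ∏ i ∈ K.erase j, shiftRatio τ (2 * η) (t i₀) (t i)
        * shiftRatio τ (2 * η) (t i) (t j) * theta τ (s + t i)) * cancel_ρ
    - c / theta τ ρ * ((∏ i ∈ K, theta τ (s + t i))
      * (theta τ (t i₀ - pPar η Λ z - qPar η Λ z - s)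
        * theta τ (qPar η Λ z - pPar η Λ z - 2 * η * (K.card - 1))
        * theta τ (2 * η * K.card))) * cancel_η

end SplitWeight

/-! ### The action of `a` and `b` on weight vectors -/

section WeightVector

variable {ι : Type*} [DecidableEq ι]

lemma sum_powerset_sum_sdiff {M : Type*} [AddCommMonoid M] (T : Finset ι)
    (F : Finset ι → Finset ι → ι → M) :
    ∑ K ∈ T.powerset, ∑ j ∈ T \ K, F (T \ K) K j
      = ∑ K ∈ T.powerset, ∑ j ∈ K, F (insert j (T \ K)) (K.erase j) j := by
  rw [Finset.sum_sigma', Finset.sum_sigma']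
  refine Finset.sum_bij' (fun a _ => ⟨insert a.2 a.1, a.2⟩) (fun a _ => ⟨a.1.erase a.2, a.2⟩)
    ?_ ?_ ?_ ?_ ?_ <;> rintro ⟨K, j⟩ h <;>
    simp only [Finset.mem_sigma, Finset.mem_powerset, Finset.mem_sdiff] at h ⊢
  · exact ⟨Finset.insert_subset h.2.1 h.1, Finset.mem_insert_self j K⟩
  · exact ⟨(Finset.erase_subset j K).trans h.1, h.1 h.2, Finset.notMem_erase j K⟩
  · rw [Finset.erase_insert h.2.2]
  · rw [Finset.insert_erase h.2]
  · rw [Finset.erase_insert h.2.2, Finset.sdiff_insert,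
      Finset.insert_erase (Finset.mem_sdiff.mpr h.2)]

lemma sum_sum_powerset_erase {M : Type*} [AddCommMonoid M] (T : Finset ι)
    (F : ι → Finset ι → Finset ι → M) :
    ∑ j ∈ T, ∑ K ∈ (T.erase j).powerset, F j (T.erase j \ K) K
      = ∑ K ∈ T.powerset, ∑ j ∈ K, F j (T \ K) (K.erase j) := by
  calc ∑ j ∈ T, ∑ K ∈ (T.erase j).powerset, F j (T.erase j \ K) K
      = ∑ K ∈ T.powerset, ∑ j ∈ T \ K, F j (T.erase j \ K) K := by
        refine Finset.sum_comm' fun j K => ?_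
        simp only [Finset.mem_powerset, Finset.mem_sdiff, Finset.subset_erase]
        tauto
    _ = ∑ K ∈ T.powerset, ∑ j ∈ T \ K, F j ((T \ K).erase j) K := by
        simp only [Finset.erase_sdiff_comm]
    _ = ∑ K ∈ T.powerset, ∑ j ∈ K, F j ((insert j (T \ K)).erase j) (K.erase j) :=
        sum_powerset_sum_sdiff T fun J K j => F j (J.erase j) K
    _ = ∑ K ∈ T.powerset, ∑ j ∈ K, F j (T \ K) (K.erase j) :=
        Finset.sum_congr rfl fun K _ => Finset.sum_congr rfl fun j hj => by
          rw [Finset.erase_insert fun h => (Finset.mem_sdiff.mp h).2 hj]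

variable (τ η : ℂ) (t : ι → ℂ)

/-- The sum over ordered partitions in the formula for the Bethe vector, up to a scalar, for the
variables indexed by `T`. It is defined by recursion on the number of tensor factors, `K` being the
part attached to the last one. -/
def weightVector : {n : ℕ} → (Fin n → ℂ) → (Fin n → ℂ) → Finset ι → ℂ → TensorSpace n
  | 0, _, _, T, _ => if T = ∅ then Finsupp.single Fin.elim0 1 else 0
  | n + 1, Λ, z, T, x => ∑ K ∈ T.powerset,
      splitWeight τ η (Λ (Fin.last n)) (z (Fin.last n)) t (T \ K) K x
        • snocMap K.card (weightVector (Fin.init Λ) (Fin.init z) (T \ K)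
          (cartanShift η (Λ (Fin.last n)) x K.card))

variable {n : ℕ}

/-- The vector `u ⊗ e_k`, where `u` is the weight vector with variables `J` of the first factors, at
the dynamical parameter which `e_k` imposes on them. -/
def splitVector (Λ z : Fin (n + 1) → ℂ) (J : Finset ι) (k : ℕ) (x : ℂ) : TensorSpace (n + 1) :=
  snocMap k (weightVector τ η t (Fin.init Λ) (Fin.init z) J (cartanShift η (Λ (Fin.last n)) x k))

/-- The assertion that `b(t_{i₀})` adds `t_{i₀}` to the variables `T` of the weight vector. -/
def RaisesAt (Λ z : Fin n → ℂ) (i₀ : ι) (T : Finset ι) (x : ℂ) : Prop :=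
  entryMap τ η Λ z 1 (-1) (t i₀) x (weightVector τ η t Λ z T (x + 2 * η))
    = -(theta τ (2 * η) / theta τ x) • weightVector τ η t Λ z (insert i₀ T) x

/-- The assertion that `a(t_{i₀})` acts on the weight vector with variables `T` by a diagonal term
and by terms in which `t_{i₀}` is interchanged with one of the variables. -/
def ExchangesAt (Λ z : Fin n → ℂ) (i₀ : ι) (T : Finset ι) (x : ℂ) : Prop :=
  entryMap τ η Λ z 1 1 (t i₀) x (weightVector τ η t Λ z T (x - 2 * η))
    = (∏ i ∈ T, shiftRatio τ (2 * η) (t i) (t i₀)) • weightVector τ η t Λ z T x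
      + ∑ j ∈ T, exchangeCoeff τ η t i₀ T j x • weightVector τ η t Λ z (insert i₀ (T.erase j)) x

variable {τ η t} {Λ z : Fin (n + 1) → ℂ} {i₀ : ι} {J T : Finset ι} {x : ℂ}

lemma weightVector_succ :
    weightVector τ η t Λ z T x = ∑ K ∈ T.powerset,
      splitWeight τ η (Λ (Fin.last n)) (z (Fin.last n)) t (T \ K) K x
        • splitVector τ η t Λ z (T \ K) K.card x := by
  rw [weightVector]
  rfl

lemma weightVector_succ_insert (hi₀ : i₀ ∉ T) :
    weightVector τ η t Λ z (insert i₀ T) x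
      = ∑ K ∈ T.powerset,
        (splitWeight τ η (Λ (Fin.last n)) (z (Fin.last n)) t (insert i₀ (T \ K)) K x
            • splitVector τ η t Λ z (insert i₀ (T \ K)) K.card x
          + splitWeight τ η (Λ (Fin.last n)) (z (Fin.last n)) t (T \ K) (insert i₀ K) x
            • splitVector τ η t Λ z (T \ K) (K.card + 1) x) := by
  rw [weightVector_succ, Finset.sum_powerset_insert hi₀, ← Finset.sum_add_distrib]
  refine Finset.sum_congr rfl fun K hK => ?_
  have hK₀ : i₀ ∉ K := fun h => hi₀ (Finset.mem_powerset.mp hK h)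
  rw [Finset.insert_sdiff_of_notMem _ hK₀, Finset.insert_sdiff_insert,
    Finset.sdiff_insert_of_notMem hi₀, Finset.card_insert_of_notMem hK₀]

lemma entryMap_b_smul_splitVector (c : ℂ) {k : ℕ}
    (hA : ExchangesAt τ η t (Fin.init Λ) (Fin.init z) i₀ J
      (cartanShift η (Λ (Fin.last n)) x (k + 1)))
    (hB : RaisesAt τ η t (Fin.init Λ) (Fin.init z) i₀ J (cartanShift η (Λ (Fin.last n)) x k)) :
    entryMap τ η Λ z 1 (-1) (t i₀) x (c • splitVector τ η t Λ z J k (x + 2 * η))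
      = (c * vermaB τ η (Λ (Fin.last n)) (z (Fin.last n)) (t i₀) x k
          * ∏ i ∈ J, shiftRatio τ (2 * η) (t i) (t i₀)) • splitVector τ η t Λ z J (k + 1) x
        - (c * vermaD τ η (Λ (Fin.last n)) (z (Fin.last n)) (t i₀) x k
          * (theta τ (2 * η) / theta τ (cartanShift η (Λ (Fin.last n)) x k)))
          • splitVector τ η t Λ z (insert i₀ J) k x
        + ∑ j ∈ J, (c * vermaB τ η (Λ (Fin.last n)) (z (Fin.last n)) (t i₀) x k
            * exchangeCoeff τ η t i₀ J j (cartanShift η (Λ (Fin.last n)) x (k + 1)))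
          • splitVector τ η t Λ z (insert i₀ (J.erase j)) (k + 1) x := by
  have shift : cartanShift η (Λ (Fin.last n)) (x + 2 * η) k
      = cartanShift η (Λ (Fin.last n)) x k + 2 * η := by
    simp only [cartanShift]
    ring
  have shift_succ : cartanShift η (Λ (Fin.last n)) x k + 2 * η
      = cartanShift η (Λ (Fin.last n)) x (k + 1) - 2 * η := by
    simp only [cartanShift]
    ring
  rw [ExchangesAt, ← shift_succ] at hA
  rw [RaisesAt] at hB
  rw [map_smul, splitVector, entryMap_b_snocMap, shift, hA, hB]
  simp only [splitVector, map_add, map_smul, map_sum, Nat.cast_succ, smul_add, Finset.smul_sum,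
    smul_smul, map_neg, smul_neg, neg_smul, mul_assoc]
  abel

lemma entryMap_a_smul_splitVector (c : ℂ) {k : ℕ}
    (hA : ExchangesAt τ η t (Fin.init Λ) (Fin.init z) i₀ J (cartanShift η (Λ (Fin.last n)) x k))
    (hB : RaisesAt τ η t (Fin.init Λ) (Fin.init z) i₀ J
      (cartanShift η (Λ (Fin.last n)) x (k - 1))) :
    entryMap τ η Λ z 1 1 (t i₀) x (c • splitVector τ η t Λ z J k (x - 2 * η))
      = (c * vermaA τ η (Λ (Fin.last n)) (z (Fin.last n)) (t i₀) x k
          * ∏ i ∈ J, shiftRatio τ (2 * η) (t i) (t i₀)) • splitVector τ η t Λ z J k x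
        - (c * vermaC τ η (Λ (Fin.last n)) (z (Fin.last n)) (t i₀) x k
          * (theta τ (2 * η) / theta τ (cartanShift η (Λ (Fin.last n)) x (k - 1))))
          • splitVector τ η t Λ z (insert i₀ J) (k - 1) x
        + ∑ j ∈ J, (c * vermaA τ η (Λ (Fin.last n)) (z (Fin.last n)) (t i₀) x k
            * exchangeCoeff τ η t i₀ J j (cartanShift η (Λ (Fin.last n)) x k))
          • splitVector τ η t Λ z (insert i₀ (J.erase j)) k x := by
  have shift : cartanShift η (Λ (Fin.last n)) (x - 2 * η) k
      = cartanShift η (Λ (Fin.last n)) x k - 2 * η := by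
    simp only [cartanShift]
    ring
  have shift_pred : cartanShift η (Λ (Fin.last n)) x k - 2 * η
      = cartanShift η (Λ (Fin.last n)) x (k - 1) + 2 * η := by
    simp only [cartanShift]
    ring
  rw [ExchangesAt] at hA
  rw [RaisesAt, ← shift_pred] at hB
  rw [map_smul, splitVector, entryMap_a_snocMap, shift, hA, hB]
  simp only [splitVector, map_add, map_smul, map_sum, smul_add, Finset.smul_sum,
    smul_smul, map_neg, smul_neg, neg_smul, mul_assoc]
  rcases Nat.eq_zero_or_pos k with rfl | hk
  · simp only [vermaC_zero, zero_mul, mul_zero, zero_smul, neg_zero, add_zero, sub_zero]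
  · rw [Nat.cast_pred hk]
    abel

lemma entryMap_b_weightVector
    (hA : ∀ K ∈ T.powerset, ExchangesAt τ η t (Fin.init Λ) (Fin.init z) i₀ (T \ K)
      (cartanShift η (Λ (Fin.last n)) x (K.card + 1)))
    (hB : ∀ K ∈ T.powerset, RaisesAt τ η t (Fin.init Λ) (Fin.init z) i₀ (T \ K)
      (cartanShift η (Λ (Fin.last n)) x K.card)) :
    letI Λ₀ := Λ (Fin.last n)
    letI z₀ := z (Fin.last n)
    entryMap τ η Λ z 1 (-1) (t i₀) x (weightVector τ η t Λ z T (x + 2 * η))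
      = ∑ K ∈ T.powerset,
        ((splitWeight τ η Λ₀ z₀ t (T \ K) K (x + 2 * η) * vermaB τ η Λ₀ z₀ (t i₀) x K.card
              * ∏ i ∈ T \ K, shiftRatio τ (2 * η) (t i) (t i₀))
            • splitVector τ η t Λ z (T \ K) (K.card + 1) x
          + ((∑ j ∈ K, splitWeight τ η Λ₀ z₀ t (insert j (T \ K)) (K.erase j) (x + 2 * η)
                * vermaB τ η Λ₀ z₀ (t i₀) x (K.erase j).card
                * exchangeCoeff τ η t i₀ (insert j (T \ K)) j (cartanShift η Λ₀ x K.card))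
              - splitWeight τ η Λ₀ z₀ t (T \ K) K (x + 2 * η) * vermaD τ η Λ₀ z₀ (t i₀) x K.card
                * (theta τ (2 * η) / theta τ (cartanShift η Λ₀ x K.card)))
            • splitVector τ η t Λ z (insert i₀ (T \ K)) K.card x) := by
  rw [weightVector_succ, map_sum,
    Finset.sum_congr rfl fun K hK => entryMap_b_smul_splitVector _ (hA K hK) (hB K hK),
    Finset.sum_add_distrib, sum_powerset_sum_sdiff T fun J K j =>
      (splitWeight τ η (Λ (Fin.last n)) (z (Fin.last n)) t J K (x + 2 * η)
        * vermaB τ η (Λ (Fin.last n)) (z (Fin.last n)) (t i₀) x K.card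
        * exchangeCoeff τ η t i₀ J j (cartanShift η (Λ (Fin.last n)) x (K.card + 1)))
        • splitVector τ η t Λ z (insert i₀ (J.erase j)) (K.card + 1) x, ← Finset.sum_add_distrib]
  refine Finset.sum_congr rfl fun K _ => ?_
  rw [sub_add_eq_add_sub, add_sub_assoc, sub_smul, Finset.sum_smul]
  refine congrArg₂ _ rfl (congrArg₂ _ (Finset.sum_congr rfl fun j hj => ?_) rfl)
  rw [Finset.erase_insert fun h => (Finset.mem_sdiff.mp h).2 hj, Finset.card_erase_add_one hj,
    cast_card_erase hj, sub_add_cancel]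

lemma raisesAt_succ (hτ : 0 < τ.im) (hi₀ : i₀ ∉ T)
    (ht : (T : Set ι).Pairwise fun i j => theta τ (t i - t j) ≠ 0)
    (ht₀ : ∀ j ∈ T, theta τ (t i₀ - t j) ≠ 0)
    (hν : ∀ K ∈ T.powerset, theta τ (cartanShift η (Λ (Fin.last n)) x K.card) ≠ 0)
    (hA : ∀ K ∈ T.powerset, ExchangesAt τ η t (Fin.init Λ) (Fin.init z) i₀ (T \ K)
      (cartanShift η (Λ (Fin.last n)) x (K.card + 1)))
    (hB : ∀ K ∈ T.powerset, RaisesAt τ η t (Fin.init Λ) (Fin.init z) i₀ (T \ K)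
      (cartanShift η (Λ (Fin.last n)) x K.card)) :
    RaisesAt τ η t Λ z i₀ T x := by
  rw [RaisesAt, entryMap_b_weightVector hA hB, weightVector_succ_insert hi₀, Finset.smul_sum]
  refine Finset.sum_congr rfl fun K hK => ?_
  have hKT := Finset.mem_powerset.mp hK
  rw [splitWeight_raise_right (fun h => hi₀ (hKT h)) x,
    splitWeight_raise_left hτ (fun h => hi₀ (Finset.mem_sdiff.mp h).1) Finset.sdiff_disjoint
      (ht.mono (Finset.coe_subset.mpr hKT)) (fun j hj => ht₀ j (hKT hj)) (hν K hK),
    smul_add, smul_smul, smul_smul]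
  exact add_comm _ _

lemma entryMap_a_weightVector
    (hA : ∀ K ∈ T.powerset, ExchangesAt τ η t (Fin.init Λ) (Fin.init z) i₀ (T \ K)
      (cartanShift η (Λ (Fin.last n)) x K.card))
    (hB : ∀ K ∈ T.powerset, RaisesAt τ η t (Fin.init Λ) (Fin.init z) i₀ (T \ K)
      (cartanShift η (Λ (Fin.last n)) x (K.card - 1))) :
    letI Λ₀ := Λ (Fin.last n)
    letI z₀ := z (Fin.last n)
    entryMap τ η Λ z 1 1 (t i₀) x (weightVector τ η t Λ z T (x - 2 * η))
      = ∑ K ∈ T.powerset,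
        ((splitWeight τ η Λ₀ z₀ t (T \ K) K (x - 2 * η) * vermaA τ η Λ₀ z₀ (t i₀) x K.card
              * ∏ i ∈ T \ K, shiftRatio τ (2 * η) (t i) (t i₀))
            • splitVector τ η t Λ z (T \ K) K.card x
          + ((∑ j ∈ K, splitWeight τ η Λ₀ z₀ t (insert j (T \ K)) (K.erase j) (x - 2 * η)
                * vermaA τ η Λ₀ z₀ (t i₀) x (K.erase j).card
                * exchangeCoeff τ η t i₀ (insert j (T \ K)) j (cartanShift η Λ₀ x (K.card - 1)))
              - splitWeight τ η Λ₀ z₀ t (T \ K) K (x - 2 * η) * vermaC τ η Λ₀ z₀ (t i₀) x K.card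
                * (theta τ (2 * η) / theta τ (cartanShift η Λ₀ x (K.card - 1))))
            • splitVector τ η t Λ z (insert i₀ (T \ K)) (K.card - 1) x) := by
  rw [weightVector_succ, map_sum,
    Finset.sum_congr rfl fun K hK => entryMap_a_smul_splitVector _ (hA K hK) (hB K hK),
    Finset.sum_add_distrib, sum_powerset_sum_sdiff T fun J K j =>
      (splitWeight τ η (Λ (Fin.last n)) (z (Fin.last n)) t J K (x - 2 * η)
        * vermaA τ η (Λ (Fin.last n)) (z (Fin.last n)) (t i₀) x K.card
        * exchangeCoeff τ η t i₀ J j (cartanShift η (Λ (Fin.last n)) x K.card))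
        • splitVector τ η t Λ z (insert i₀ (J.erase j)) K.card x, ← Finset.sum_add_distrib]
  refine Finset.sum_congr rfl fun K _ => ?_
  rw [sub_add_eq_add_sub, add_sub_assoc, sub_smul, Finset.sum_smul]
  refine congrArg₂ _ rfl (congrArg₂ _ (Finset.sum_congr rfl fun j hj => ?_) rfl)
  rw [Finset.erase_insert fun h => (Finset.mem_sdiff.mp h).2 hj, cast_card_erase hj,
    Finset.card_erase_of_mem hj]

lemma sum_exchangeCoeff_smul_weightVector (hi₀ : i₀ ∉ T) :
    ∑ j ∈ T, exchangeCoeff τ η t i₀ T j x • weightVector τ η t Λ z (insert i₀ (T.erase j)) x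
      = ∑ K ∈ T.powerset,
        ((∑ j ∈ K, exchangeCoeff τ η t i₀ T j x * splitWeight τ η (Λ (Fin.last n))
              (z (Fin.last n)) t (insert i₀ (T \ K)) (K.erase j) x)
            • splitVector τ η t Λ z (insert i₀ (T \ K)) (K.card - 1) x
          + (∑ j ∈ K, exchangeCoeff τ η t i₀ T j x * splitWeight τ η (Λ (Fin.last n))
              (z (Fin.last n)) t (T \ K) (insert i₀ (K.erase j)) x)
            • splitVector τ η t Λ z (T \ K) K.card x) := by
  simp only [weightVector_succ_insert fun h => hi₀ (Finset.mem_of_mem_erase h), Finset.smul_sum]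
  rw [sum_sum_powerset_erase T fun j J K => exchangeCoeff τ η t i₀ T j x
    • (splitWeight τ η (Λ (Fin.last n)) (z (Fin.last n)) t (insert i₀ J) K x
          • splitVector τ η t Λ z (insert i₀ J) K.card x
        + splitWeight τ η (Λ (Fin.last n)) (z (Fin.last n)) t J (insert i₀ K) x
          • splitVector τ η t Λ z J (K.card + 1) x)]
  refine Finset.sum_congr rfl fun K _ => ?_
  rw [Finset.sum_smul, Finset.sum_smul, ← Finset.sum_add_distrib]
  refine Finset.sum_congr rfl fun j hj => ?_
  rw [Finset.card_erase_add_one hj, Finset.card_erase_of_mem hj, smul_add, smul_smul, smul_smul]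

lemma exchangesAt_succ (hτ : 0 < τ.im) (hη : theta τ (2 * η) ≠ 0) (hi₀ : i₀ ∉ T)
    (ht : (T : Set ι).Pairwise fun i j => theta τ (t i - t j) ≠ 0)
    (ht₀ : ∀ j ∈ T, theta τ (t i₀ - t j) ≠ 0)
    (hq : ∀ j ∈ insert i₀ T, theta τ (t j - qPar η (Λ (Fin.last n)) (z (Fin.last n))) ≠ 0)
    (hx : theta τ x ≠ 0)
    (hν : ∀ K ∈ T.powerset, theta τ (cartanShift η (Λ (Fin.last n)) x (K.card - 1)) ≠ 0)
    (hA : ∀ K ∈ T.powerset, ExchangesAt τ η t (Fin.init Λ) (Fin.init z) i₀ (T \ K)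
      (cartanShift η (Λ (Fin.last n)) x K.card))
    (hB : ∀ K ∈ T.powerset, RaisesAt τ η t (Fin.init Λ) (Fin.init z) i₀ (T \ K)
      (cartanShift η (Λ (Fin.last n)) x (K.card - 1))) :
    ExchangesAt τ η t Λ z i₀ T x := by
  rw [ExchangesAt, entryMap_a_weightVector hA hB, sum_exchangeCoeff_smul_weightVector hi₀,
    weightVector_succ, Finset.smul_sum, ← Finset.sum_add_distrib]
  refine Finset.sum_congr rfl fun K hK => ?_
  have hKT := Finset.mem_powerset.mp hK
  have hi₀K : i₀ ∉ K := fun h => hi₀ (hKT h)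
  have hi₀J : i₀ ∉ T \ K := fun h => hi₀ (Finset.mem_sdiff.mp h).1
  have htK := ht.mono (Finset.coe_subset.mpr hKT)
  have ht₀K : ∀ j ∈ K, theta τ (t i₀ - t j) ≠ 0 := fun j hj => ht₀ j (hKT hj)
  have hqK : ∀ j ∈ K, theta τ (t j - qPar η (Λ (Fin.last n)) (z (Fin.last n))) ≠ 0 :=
    fun j hj => hq j (Finset.mem_insert_of_mem (hKT hj))
  rw [splitWeight_diagonal hτ hi₀K Finset.sdiff_disjoint htK ht₀K
      (hq i₀ (Finset.mem_insert_self i₀ T)) hqK hx,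
    splitWeight_exchange hτ hη hi₀J Finset.sdiff_disjoint htK ht₀K hqK (hν K hK),
    Finset.sdiff_union_of_subset hKT, add_smul, smul_smul]
  abel

lemma entryMap_zero (Λ z : Fin 0 → ℂ) (β α : ℤˣ) (w : ℂ) (v : TensorSpace 0) :
    entryMap τ η Λ z β α w x v = if α = β then v else 0 := by
  induction v using Finsupp.induction_linear with
  | zero => simp only [map_zero, ite_self]
  | add f g hf hg => rw [map_add, hf, hg]; split_ifs <;> simp only [add_zero]
  | single κ a =>
    simp only [entryMap, LinearMap.comp_apply, auxTensorMap_single, tensorL, List.finRange_zero,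
      List.map_nil, List.prod_nil, Module.End.one_apply, auxComponentMap_single]

lemma raisesAt_zero (Λ z : Fin 0 → ℂ) : RaisesAt τ η t Λ z i₀ T x := by
  rw [RaisesAt, entryMap_zero, if_neg (by decide), weightVector,
    if_neg (Finset.insert_ne_empty i₀ T), smul_zero]

lemma exchangesAt_zero (Λ z : Fin 0 → ℂ) : ExchangesAt τ η t Λ z i₀ T x := by
  rw [ExchangesAt, entryMap_zero, if_pos rfl]
  simp only [weightVector, if_neg (Finset.insert_ne_empty i₀ _), smul_zero,
    Finset.sum_const_zero, add_zero]
  split_ifs with h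
  · rw [h, Finset.prod_empty, one_smul]
  · rw [smul_zero]

lemma tendsto_cartanShift_codiscrete (η Λ k : ℂ) :
    Tendsto (fun x => cartanShift η Λ x k) (codiscrete ℂ) (codiscrete ℂ) := by
  simpa only [cartanShift, sub_eq_add_neg] using
    tendsto_add_right_codiscrete (-(2 * η * (Λ - 2 * k)))

theorem eventually_raisesAt_and_exchangesAt (hτ : 0 < τ.im) (hη : theta τ (2 * η) ≠ 0) {n : ℕ}
    (Λ z : Fin n → ℂ) (hi₀ : i₀ ∉ T) (ht : (T : Set ι).Pairwise fun i j => theta τ (t i - t j) ≠ 0)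
    (ht₀ : ∀ j ∈ T, theta τ (t i₀ - t j) ≠ 0)
    (hq : ∀ j ∈ insert i₀ T, ∀ k, theta τ (t j - qPar η (Λ k) (z k)) ≠ 0) :
    (∀ᶠ x in codiscrete ℂ, RaisesAt τ η t Λ z i₀ T x)
      ∧ ∀ᶠ x in codiscrete ℂ, ExchangesAt τ η t Λ z i₀ T x := by
  induction n generalizing T with
  | zero => exact ⟨.of_forall fun x => raisesAt_zero Λ z, .of_forall fun x => exchangesAt_zero Λ z⟩
  | succ n ih =>
    have ih' : ∀ K ∈ T.powerset,
        (∀ᶠ x in codiscrete ℂ, RaisesAt τ η t (Fin.init Λ) (Fin.init z) i₀ (T \ K) x)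
        ∧ ∀ᶠ x in codiscrete ℂ, ExchangesAt τ η t (Fin.init Λ) (Fin.init z) i₀ (T \ K) x :=
      fun K _ => ih (Fin.init Λ) (Fin.init z) (fun h => hi₀ (Finset.mem_sdiff.mp h).1)
        (ht.mono (Finset.coe_subset.mpr Finset.sdiff_subset))
        (fun j hj => ht₀ j (Finset.mem_sdiff.mp hj).1)
        (fun j hj k => hq j (Finset.insert_subset_insert i₀ Finset.sdiff_subset hj) k.castSucc)
    have hν : ∀ k : Finset ι → ℂ, ∀ᶠ x in codiscrete ℂ, ∀ K ∈ T.powerset,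
        theta τ (cartanShift η (Λ (Fin.last n)) x (k K)) ≠ 0 := fun k =>
      (Finset.eventually_all _).mpr fun K _ =>
        (tendsto_cartanShift_codiscrete η _ (k K)).eventually (eventually_theta_ne_zero hτ)
    have hB : ∀ k : Finset ι → ℂ, ∀ᶠ x in codiscrete ℂ, ∀ K ∈ T.powerset,
        RaisesAt τ η t (Fin.init Λ) (Fin.init z) i₀ (T \ K)
          (cartanShift η (Λ (Fin.last n)) x (k K)) := fun k =>
      (Finset.eventually_all _).mpr fun K hK =>
        (tendsto_cartanShift_codiscrete η _ (k K)).eventually (ih' K hK).1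
    have hA : ∀ k : Finset ι → ℂ, ∀ᶠ x in codiscrete ℂ, ∀ K ∈ T.powerset,
        ExchangesAt τ η t (Fin.init Λ) (Fin.init z) i₀ (T \ K)
          (cartanShift η (Λ (Fin.last n)) x (k K)) := fun k =>
      (Finset.eventually_all _).mpr fun K hK =>
        (tendsto_cartanShift_codiscrete η _ (k K)).eventually (ih' K hK).2
    constructor
    · filter_upwards [hν _, hA _, hB _] with x hxν hxA hxB
      exact raisesAt_succ hτ hi₀ ht ht₀ hxν hxA hxB
    · filter_upwards [eventually_theta_ne_zero hτ, hν _, hA _, hB _] with x hx hxν hxA hxB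
      exact exchangesAt_succ hτ hη hi₀ ht ht₀ (fun j hj => hq j hj _) hx hxν hxA hxB

end WeightVector

/-! ### The sum over ordered partitions -/

section OrderedPartition

variable {ι κ : Type*}

/-- The sets `I l` are disjoint, possibly empty, and have union `T`. -/
def IsOrderedPartition (T : Finset ι) (I : κ → Finset ι) : Prop :=
  (∀ l, I l ⊆ T) ∧ ∀ i ∈ T, ∃! l, i ∈ I l

lemma IsOrderedPartition.prod_prod [Fintype κ] {M : Type*} [CommMonoid M] {T : Finset ι}
    {I : κ → Finset ι} (h : IsOrderedPartition T I) (f : ι → M) :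
    ∏ l, ∏ i ∈ I l, f i = ∏ i ∈ T, f i := by
  classical
  have hT : T = Finset.univ.biUnion I := by
    ext i
    simp only [Finset.mem_biUnion, Finset.mem_univ, true_and]
    exact ⟨fun hi => (h.2 i hi).exists, fun ⟨l, hl⟩ => h.1 l hl⟩
  rw [hT, Finset.prod_biUnion]
  refine fun k _ l _ hkl => Finset.disjoint_left.mpr fun i hk hl => hkl ?_
  exact (h.2 i (h.1 k hk)).unique hk hl

lemma isOrderedPartition_snoc [DecidableEq ι] {n : ℕ} {T K : Finset ι} {I : Fin n → Finset ι} :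
    IsOrderedPartition T (Fin.snoc I K : Fin (n + 1) → Finset ι)
      ↔ K ⊆ T ∧ IsOrderedPartition (T \ K) I := by
  simp only [IsOrderedPartition, ExistsUnique, Fin.forall_fin_succ', Fin.exists_fin_succ',
    Fin.snoc_castSucc, Fin.snoc_last, Fin.castSucc_inj, Finset.subset_iff, Finset.mem_sdiff]
  grind

end OrderedPartition

section ExplicitFormula

variable {n m : ℕ}

/-- The ordered partitions of `T` into `n` subsets; for `T = {1, …, m}` these are the
`partitions n m`. -/
def partitionsOf (n : ℕ) (T : Finset (Fin m)) : Finset (Fin n → Finset (Fin m)) :=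
  open Classical in Finset.univ.filter fun I => IsOrderedPartition T I

lemma mem_partitionsOf {T : Finset (Fin m)} {I : Fin n → Finset (Fin m)} :
    I ∈ partitionsOf n T ↔ IsOrderedPartition T I := by
  simp only [partitionsOf, Finset.mem_filter, Finset.mem_univ, true_and]

lemma partitionsOf_univ (n m : ℕ) :
    partitionsOf n (Finset.univ : Finset (Fin m)) = partitions n m := by
  ext I
  simp only [mem_partitionsOf, IsOrderedPartition, partitions, Finset.mem_filter, Finset.mem_univ,
    Finset.subset_univ, implies_true, true_and, forall_const]

lemma partitionsOf_zero (T : Finset (Fin m)) :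
    partitionsOf 0 T = if T = ∅ then {Fin.elim0} else ∅ := by
  ext I
  split_ifs with hT
  · simp [mem_partitionsOf, IsOrderedPartition, hT, eq_iff_true_of_subsingleton]
  · obtain ⟨i, hi⟩ := Finset.nonempty_iff_ne_empty.mpr hT
    simp only [mem_partitionsOf, IsOrderedPartition, Finset.notMem_empty, iff_false, not_and]
    exact fun _ h => (h i hi).exists.elim fun l => l.elim0

lemma sum_partitionsOf_succ {M : Type*} [AddCommMonoid M] (T : Finset (Fin m))
    (f : (Fin (n + 1) → Finset (Fin m)) → M) :
    ∑ I ∈ partitionsOf (n + 1) T, f I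
      = ∑ K ∈ T.powerset, ∑ I ∈ partitionsOf n (T \ K), f (Fin.snoc I K) := by
  rw [Finset.sum_sigma']
  refine Finset.sum_bij' (fun I _ => ⟨I (Fin.last n), Fin.init I⟩) (fun a _ => Fin.snoc a.2 a.1)
    (fun I hI => ?_) (fun a ha => ?_) (fun I _ => Fin.snoc_init_self I) (fun a _ => ?_)
    (fun I _ => by rw [Fin.snoc_init_self])
  · rw [mem_partitionsOf, ← Fin.snoc_init_self I, isOrderedPartition_snoc] at hI
    exact Finset.mem_sigma.mpr ⟨Finset.mem_powerset.mpr hI.1, mem_partitionsOf.mpr hI.2⟩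
  · simp only [Finset.mem_sigma, Finset.mem_powerset, mem_partitionsOf] at ha
    exact mem_partitionsOf.mpr (isOrderedPartition_snoc.mpr ha)
  · simp only [Fin.snoc_last, Fin.init_snoc]

lemma prod_Ioi_castSucc {M : Type*} [CommMonoid M] (i : Fin n) (f : Fin (n + 1) → M) :
    ∏ l ∈ Finset.Ioi i.castSucc, f l = (∏ l ∈ Finset.Ioi i, f l.castSucc) * f (Fin.last n) :=
  sum_Ioi_castSucc (M := Additive M) i f

variable {τ η : ℂ}

lemma betheCoeff_snoc (Λ z : Fin (n + 1) → ℂ) (t : Fin m → ℂ) {J : Finset (Fin m)}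
    (K : Finset (Fin m)) {I : Fin n → Finset (Fin m)} (hI : IsOrderedPartition J I) (x : ℂ) :
    betheCoeff τ η Λ z t (Fin.snoc I K) x
      = splitWeight τ η (Λ (Fin.last n)) (z (Fin.last n)) t J K x
        * betheCoeff τ η (Fin.init Λ) (Fin.init z) t I
          (cartanShift η (Λ (Fin.last n)) x K.card) := by
  have shift : ∀ (k : Fin n) (j : Fin m) (S : ℂ),
      x + t j - qPar η (Λ k.castSucc) (z k.castSucc) + 2 * η * ((I k).card : ℂ)
        - 2 * η * (S + (Λ (Fin.last n) - 2 * (K.card : ℂ)))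
      = cartanShift η (Λ (Fin.last n)) x K.card + t j - qPar η (Λ k.castSucc) (z k.castSucc)
        + 2 * η * ((I k).card : ℂ) - 2 * η * S := fun k j S => by
    rw [cartanShift]
    ring
  have shift_last : ∀ j,
      x + t j - qPar η (Λ (Fin.last n)) (z (Fin.last n)) + 2 * η * (K.card : ℂ)
        = x - qPar η (Λ (Fin.last n)) (z (Fin.last n)) + 2 * η * K.card + t j := fun j => by ring
  rw [splitWeight, splitFactor, ← hI.prod_prod, ← hI.prod_prod]
  simp only [betheCoeff, Fin.prod_univ_castSucc, prod_Ioi_castSucc, sum_Ioi_castSucc,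
    Ioi_last_eq_empty, Fin.snoc_castSucc, Fin.snoc_last, Finset.prod_empty, Finset.sum_empty,
    Finset.prod_const_one, mul_one, mul_zero, sub_zero, Finset.prod_mul_distrib, shift, shift_last,
    Finset.prod_div_distrib, Finset.prod_inv_distrib, shiftRatio, Fin.init]
  ring

lemma weightVector_eq_sum (t : Fin m → ℂ) {n : ℕ} (Λ z : Fin n → ℂ) (T : Finset (Fin m)) (x : ℂ) :
    weightVector τ η t Λ z T x = ∑ I ∈ partitionsOf n T,
      betheCoeff τ η Λ z t I x • Finsupp.single (fun k => (I k).card) (1 : ℂ) := by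
  induction n generalizing T x with
  | zero =>
    rw [weightVector, partitionsOf_zero]
    split_ifs with hT
    · rw [Finset.sum_singleton]
      simp only [betheCoeff, Finset.univ_eq_empty, Finset.prod_empty, mul_one, one_smul]
      congr 1
      exact Subsingleton.elim _ _
    · rw [Finset.sum_empty]
  | succ n ih =>
    rw [weightVector_succ, sum_partitionsOf_succ]
    refine Finset.sum_congr rfl fun K _ => ?_
    rw [splitVector, ih, map_sum, Finset.smul_sum]
    refine Finset.sum_congr rfl fun I hI => ?_
    have card_snoc : (fun k => ((Fin.snoc I K : Fin (n + 1) → Finset (Fin m)) k).card)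
        = Fin.snoc (fun k => (I k).card) K.card := by
      ext k
      induction k using Fin.lastCases <;> simp only [Fin.snoc_last, Fin.snoc_castSucc]
    rw [betheCoeff_snoc Λ z t K (mem_partitionsOf.mp hI), card_snoc, map_smul, snocMap_single,
      smul_smul]

lemma weightVector_empty {ι : Type*} [DecidableEq ι] (t : ι → ℂ) {n : ℕ} (Λ z : Fin n → ℂ)
    (x : ℂ) : weightVector τ η t Λ z ∅ x = Finsupp.single (fun _ => 0) 1 := by
  induction n generalizing x with
  | zero =>
    rw [weightVector, if_pos rfl]
    congr 1
    exact Subsingleton.elim _ _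
  | succ n ih =>
    have snoc_zero : (Fin.snoc (fun _ => 0) 0 : Fin (n + 1) → ℕ) = fun _ => 0 := by
      ext k
      induction k using Fin.lastCases <;> simp only [Fin.snoc_last, Fin.snoc_castSucc]
    rw [weightVector_succ, Finset.powerset_empty, Finset.sum_singleton, Finset.sdiff_empty,
      splitVector, ih, snocMap_single, Finset.card_empty, snoc_zero]
    simp only [splitWeight, splitFactor, Finset.prod_empty, mul_one, one_smul]

lemma bOp_apply (Λ z : Fin n → ℂ) (w : ℂ) (f : ℂ → TensorSpace n) (x : ℂ) :
    bOp τ η Λ z w f x = entryMap τ η Λ z 1 (-1) w x (f (x + 2 * η)) := by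
  rw [bOp, entryOp_apply, Units.val_neg, Units.val_one, Int.cast_neg, Int.cast_one, mul_neg_one,
    sub_neg_eq_add]

lemma foldr_bOp_eventuallyEq {ι : Type*} [DecidableEq ι] (hτ : 0 < τ.im)
    (hη : theta τ (2 * η) ≠ 0) (Λ z : Fin n → ℂ) {t : ι → ℂ}
    (hq : ∀ i k, theta τ (t i - qPar η (Λ k) (z k)) ≠ 0)
    (ht : Pairwise fun i j => theta τ (t i - t j) ≠ 0) (g : ℂ → ℂ) {l : List ι} (hl : l.Nodup) :
    l.foldr (fun i f => bOp τ η Λ z (t i) f) (fun x => Finsupp.single (fun _ => 0) (g x))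
      =ᶠ[codiscrete ℂ] fun x => ((-theta τ (2 * η)) ^ l.length
        / (∏ j ∈ Finset.range l.length, theta τ (x + 2 * η * j)) * g (x + 2 * η * l.length))
          • weightVector τ η t Λ z l.toFinset x := by
  induction l with
  | nil =>
    refine .of_forall fun x => ?_
    simp [weightVector_empty]
  | cons i l ih =>
    obtain ⟨hi, hl⟩ := List.nodup_cons.mp hl
    have hi' : i ∉ l.toFinset := fun h => hi (List.mem_toFinset.mp h)
    have raises : ∀ᶠ x in codiscrete ℂ, RaisesAt τ η t Λ z i l.toFinset x :=
      (eventually_raisesAt_and_exchangesAt hτ hη Λ z hi' (ht.set_pairwise _)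
        (fun j hj => ht fun h => hi' (h ▸ hj)) (fun j _ k => hq j k)).1
    filter_upwards [(tendsto_add_right_codiscrete (2 * η)).eventually (ih hl), raises]
      with x ih_x raises_x
    have shift : ∀ j : ℕ, x + 2 * η * ((j + 1 : ℕ) : ℂ) = x + 2 * η + 2 * η * j := fun j => by
      push_cast
      ring
    rw [RaisesAt] at raises_x
    rw [List.foldr_cons, bOp_apply, ih_x, map_smul, raises_x, smul_smul, List.toFinset_cons,
      List.length_cons, Finset.prod_range_succ', pow_succ]
    simp only [shift, Nat.cast_zero, mul_zero, add_zero]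
    congr 1
    ring

lemma prod_theta_Icc (x : ℂ) (m : ℕ) :
    ∏ j ∈ Finset.Icc 1 m, theta τ (x + 2 * η * m - 2 * η * (j : ℂ))
      = ∏ j ∈ Finset.range m, theta τ (x + 2 * η * j) := by
  rw [← Finset.prod_range_reflect, ← Finset.Ico_succ_right_eq_Icc, Finset.prod_Ico_eq_prod_range]
  refine Finset.prod_congr (by simp) fun j hj => ?_
  rw [Nat.sub_sub, Nat.cast_sub (by simp at hj; lia)]
  congr 1
  push_cast
  ring

variable (τ η) in
/-- The right-hand side of the formula for the Bethe vector. -/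
def betheFormula (Λ z : Fin n → ℂ) (c : ℂ) (t : Fin m → ℂ) (x : ℂ) : TensorSpace n :=
  ((-1) ^ m * Complex.exp (c * (x + 2 * η * m))) •
    ∑ I ∈ partitions n m, betheCoeff τ η Λ z t I x • Finsupp.single (fun k => (I k).card) (1 : ℂ)

lemma betheVector_eventuallyEq (hτ : 0 < τ.im) (hη : theta τ (2 * η) ≠ 0) (Λ z : Fin n → ℂ) (c : ℂ)
    {t : Fin m → ℂ} (hq : ∀ i k, theta τ (t i - qPar η (Λ k) (z k)) ≠ 0)
    (ht : Pairwise fun i j => theta τ (t i - t j) ≠ 0) :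
    betheVector τ η Λ z c t =ᶠ[codiscrete ℂ] betheFormula τ η Λ z c t := by
  have hθ : ∀ᶠ x in codiscrete ℂ, ∀ j ∈ Finset.range m, theta τ (x + 2 * η * j) ≠ 0 :=
    (Finset.eventually_all _).mpr fun j _ => eventually_theta_add_ne_zero hτ _
  filter_upwards [foldr_bOp_eventuallyEq hτ hη Λ z hq ht (fun x => Complex.exp (c * x)
      * ∏ j ∈ Finset.Icc 1 m, (theta τ (x - 2 * η * (j : ℂ)) / theta τ (2 * η)))
      (List.nodup_finRange m), hθ] with x hx hθx
  have hP : ∏ j ∈ Finset.range m, theta τ (x + 2 * η * j) ≠ 0 := Finset.prod_ne_zero_iff.mpr hθx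
  have scalar : (-theta τ (2 * η)) ^ m / (∏ j ∈ Finset.range m, theta τ (x + 2 * η * j))
      * (Complex.exp (c * (x + 2 * η * m))
        * ∏ j ∈ Finset.Icc 1 m, (theta τ (x + 2 * η * m - 2 * η * (j : ℂ)) / theta τ (2 * η)))
      = (-1) ^ m * Complex.exp (c * (x + 2 * η * m)) := by
    rw [Finset.prod_div_distrib, prod_theta_Icc, Finset.prod_const, Nat.card_Icc,
      Nat.add_sub_cancel, neg_pow]
    field_simp
  refine Eq.trans hx ?_
  rw [List.length_finRange, scalar, List.toFinset_finRange, weightVector_eq_sum,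
    partitionsOf_univ, betheFormula]

/-! ### The formula defines an entire function -/

lemma prod_const_of_mem_partitions {I : Fin n → Finset (Fin m)} (hI : I ∈ partitions n m) (a : ℂ) :
    ∏ k, ∏ _j ∈ I k, a = a ^ m := by
  rw [← partitionsOf_univ, mem_partitionsOf] at hI
  rw [hI.prod_prod fun _ => a, Finset.prod_const, Finset.card_univ, Fintype.card_fin]

lemma betheCoeff_add_one (Λ z : Fin n → ℂ) (t : Fin m → ℂ) {I : Fin n → Finset (Fin m)}
    (hI : I ∈ partitions n m) (x : ℂ) :
    betheCoeff τ η Λ z t I (x + 1) = (-1) ^ m * betheCoeff τ η Λ z t I x := by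
  have theta_shift : ∀ (k : Fin n) (j : Fin m) (S : ℂ),
      theta τ (x + 1 + t j - qPar η (Λ k) (z k) + 2 * η * ((I k).card : ℂ) - 2 * η * S)
      = -1 * theta τ (x + t j - qPar η (Λ k) (z k) + 2 * η * ((I k).card : ℂ) - 2 * η * S) :=
    fun k j S => by
      rw [neg_one_mul, ← theta_add_one]
      ring_nf
  simp only [betheCoeff, theta_shift, mul_div_assoc, Finset.prod_mul_distrib,
    prod_const_of_mem_partitions hI]
  ring

lemma differentiable_betheCoeff (hτ : 0 < τ.im) (Λ z : Fin n → ℂ) (t : Fin m → ℂ)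
    (I : Fin n → Finset (Fin m)) : Differentiable ℂ (betheCoeff τ η Λ z t I) := by
  have := differentiable_theta hτ
  unfold betheCoeff
  fun_prop

lemma isEntire_sum_smul_single {α : Type*} {S : Finset α} {f : α → ℂ → ℂ}
    (hf : ∀ a ∈ S, Differentiable ℂ (f a)) (κ : α → Fin n → ℕ) :
    IsEntire fun x => ∑ a ∈ S, f a x • Finsupp.single (κ a) (1 : ℂ) := by
  classical
  refine ⟨⟨S.image κ, fun x => Finsupp.support_finsetSum.trans ?_⟩, fun κ' => ?_⟩
  · refine Finset.biUnion_subset.mpr fun a ha => Finsupp.support_smul.trans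
      (Finsupp.support_single_subset.trans ?_)
    exact Finset.singleton_subset_iff.mpr (Finset.mem_image_of_mem κ ha)
  · simp only [Finsupp.finsetSum_apply, Finsupp.smul_apply]
    exact Differentiable.fun_sum fun a ha => (hf a ha).smul_const _

lemma IsEntire.smul {f : ℂ → TensorSpace n} (hf : IsEntire f) {g : ℂ → ℂ}
    (hg : Differentiable ℂ g) : IsEntire fun x => g x • f x := by
  obtain ⟨⟨S, hS⟩, hdiff⟩ := hf
  exact ⟨⟨S, fun x => Finsupp.support_smul.trans (hS x)⟩, fun κ => hg.mul (hdiff κ)⟩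

lemma isEntire_betheFormula (hτ : 0 < τ.im) (Λ z : Fin n → ℂ) (c : ℂ) (t : Fin m → ℂ) :
    IsEntire (betheFormula τ η Λ z c t) :=
  (isEntire_sum_smul_single (fun I _ => differentiable_betheCoeff hτ Λ z t I) _).smul (by fun_prop)

lemma betheFormula_add_one (Λ z : Fin n → ℂ) (c : ℂ) (t : Fin m → ℂ) (x : ℂ) :
    betheFormula τ η Λ z c t (x + 1)
      = ((-1) ^ m * Complex.exp c) • betheFormula τ η Λ z c t x := by
  have hexp : Complex.exp (c * (x + 1 + 2 * η * m))
      = Complex.exp c * Complex.exp (c * (x + 2 * η * m)) := by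
    rw [← Complex.exp_add]
    ring_nf
  simp only [betheFormula, hexp, Finset.smul_sum, smul_smul]
  refine Finset.sum_congr rfl fun I hI => ?_
  rw [betheCoeff_add_one Λ z t hI]
  congr 1
  ring

end ExplicitFormula

end EllipticBethe

end

theorem mainTheorem2 (τ η : ℂ) (hτ : 0 < τ.im) (hη : 2 * η ∉ EllipticBethe.lattice τ)
    (n m : ℕ) (Λ z : Fin n → ℂ) (c : ℂ) (t : Fin m → ℂ)
    (htq : ∀ i k, t i - EllipticBethe.qPar η (Λ k) (z k) ∉ EllipticBethe.lattice τ)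
    (htt : ∀ i j, i < j → t i - t j ∉ EllipticBethe.lattice τ) :
    EllipticBethe.betheVector τ η Λ z c t =ᶠ[Filter.codiscrete ℂ]
      (fun x => ((-1) ^ m * Complex.exp (c * (x + 2 * η * m))) •
        ∑ I ∈ EllipticBethe.partitions n m,
          EllipticBethe.betheCoeff τ η Λ z t I x •
            Finsupp.single (fun k => (I k).card) (1 : ℂ)) ∧
    ∃ ψ : ℂ → EllipticBethe.TensorSpace n,
      EllipticBethe.betheVector τ η Λ z c t =ᶠ[Filter.codiscrete ℂ] ψ ∧
      EllipticBethe.IsEntire ψ ∧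
      ∀ x, ψ (x + 1) = ((-1) ^ m * Complex.exp c) • ψ x := by
  have hη' : EllipticBethe.theta τ (2 * η) ≠ 0 := EllipticBethe.theta_ne_zero hτ hη
  have htq' : ∀ i k, EllipticBethe.theta τ (t i - EllipticBethe.qPar η (Λ k) (z k)) ≠ 0 :=
    fun i k => EllipticBethe.theta_ne_zero hτ (htq i k)
  have htt' : Pairwise fun i j => EllipticBethe.theta τ (t i - t j) ≠ 0 := by
    intro i j hij
    rcases lt_or_gt_of_ne hij with h | h
    · exact EllipticBethe.theta_ne_zero hτ (htt i j h)
    · exact EllipticBethe.theta_sub_ne_zero_comm.mp (EllipticBethe.theta_ne_zero hτ (htt j i h))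
  have explicit_formula := EllipticBethe.betheVector_eventuallyEq hτ hη' Λ z c htq' htt'
  exact ⟨explicit_formula, _, explicit_formula, EllipticBethe.isEntire_betheFormula hτ Λ z c t,
    EllipticBethe.betheFormula_add_one Λ z c t⟩
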